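/- For an integrable function $f:\mathbb R\to\mathbb R$ and $T>0$ put $\widehat f(t)=\int_{\mathbb R}e^{i\lambda t}f(\lambda)\,d\lambda$, and let $W_T(f)$ be the truncated Toeplitz operator on the complex Hilbert space $L^2[0,T]$ given by $$[W_T(f)u](t)=\int_0^T\widehat f(t-s)\,u(s)\,ds .$$ Let $m\ge 1$ and let $h_1,\dots,h_m:\mathbb R\to\mathbb R$ be integrable and symmetric, $h_i(-\lambda)=h_i(\lambda)$. Then for every $T>0$ the operator $W_T(h_1)W_T(h_2)\cdots W_T(h_m)$ is of trace class. Put $$\Delta(T)=\left|\frac1T\,\mathrm{tr}\left[\prod_{i=1}^m W_T(h_i)\right]-(2\pi)^{m-1}\int_{\mathbb R}\prod_{i=1}^m h_i(\lambda)\,d\lambda\right| ,$$ where $\prod_i h_i$ is assumed or shown to be integrable, as stated below. Each of the following conditions is sufficient for $\Delta(T)=o(1)$ as $T\to\infty$: (A1) $h_i\in L^1(\mathbb R)\cap L^{p_i}(\mathbb R)$ with $1<p_i\le\infty$, $i=1,\dots,m$, and $\frac1{p_1}+\cdots+\frac1{p_m}\le 1$ (where $1/\infty=0$). In this case $\prod_i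 h_i$ is integrable. (A2) $m\ge2$, the product $\prod_i h_i$ is integrable, and the function $$\varphi(\mathbf u)=\int_{\mathbb R}h_1(\lambda)h_2(\lambda-u_1)h_3(\lambda-u_2)\cdots h_m(\lambda-u_{m-1})\,d\lambda,\qquad \mathbf u=(u_1,\dots,u_{m-1})\in\mathbb R^{m-1},$$ belongs to $L^{m-2}(\mathbb R^{m-1})$ and is continuous at $\mathbf 0=(0,\dots,0)$. Here $\varphi(\mathbf u)$ is set to be $0$ on the null set of those $\mathbf u$ for which the integral does not converge absolutely, and for $m=2$ the condition $\varphi\in L^{0}(\mathbb R)$ means only that $\varphi$ is Lebesgue measurable. -/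

import Mathlib

open MeasureTheory Filter Topology
open scoped ENNReal InnerProductSpace

noncomputable section

namespace TruncatedToeplitz

/-! ### Trace class operators on a complex Hilbert space -/

section Trace

variable {H : Type*} [NormedAddCommGroup H] [InnerProductSpace ℂ H]

/-- Trace class (nuclear) operators: `A v = ∑ ⟪x k, v⟫ y k` with `∑ ‖x k‖ ‖y k‖ < ∞`. -/
def IsTraceClass (A : H →L[ℂ] H) : Prop :=
  ∃ x y : ℕ → H, Summable (fun k => ‖x k‖ * ‖y k‖) ∧
    ∀ v : H, HasSum (fun k => ⟪x k, v⟫_ℂ • y k) (A v)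

variable [CompleteSpace H]

/-- The trace `∑ ⟪e i, A (e i)⟫`, computed in some orthonormal basis `e` of the Hilbert space.
For a trace class operator the sum converges and is the same in every orthonormal basis, see
`IsTraceClass.hasSum_trace`. -/
def trace (A : H →L[ℂ] H) : ℂ :=
  ∑' i, ⟪(exists_hilbertBasis ℂ H).choose_spec.choose i,
    A ((exists_hilbertBasis ℂ H).choose_spec.choose i)⟫_ℂ

/-- In every orthonormal basis the trace series of a trace class operator converges to
`∑ ⟪x k, y k⟫`. -/
theorem hasSum_inner_basis {A : H →L[ℂ] H} {x y : ℕ → H}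
    (hxy : Summable (fun k => ‖x k‖ * ‖y k‖))
    (hA : ∀ v : H, HasSum (fun k => ⟪x k, v⟫_ℂ • y k) (A v))
    {ι : Type*} (b : HilbertBasis ι ℂ H) :
    HasSum (fun i => ⟪b i, A (b i)⟫_ℂ) (∑' k, ⟪x k, y k⟫_ℂ) := by
  set F : ι × ℕ → ℂ := fun q => ⟪x q.2, b q.1⟫_ℂ * ⟪b q.1, y q.2⟫_ℂ with hF
  have hsq : ∀ (v : H), HasSum (fun i => ‖⟪b i, v⟫_ℂ‖ ^ 2) (‖v‖ ^ 2) := by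
    intro v
    have h1 := b.hasSum_inner_mul_inner v v
    have h2 := Complex.reCLM.hasSum h1
    have h3 : Complex.reCLM ⟪v, v⟫_ℂ = ‖v‖ ^ 2 := by
      rw [inner_self_eq_norm_sq_to_K]
      norm_cast
    rw [h3] at h2
    have h4 : (fun i => ‖⟪b i, v⟫_ℂ‖ ^ 2)
        = fun i => Complex.reCLM (⟪v, b i⟫_ℂ * ⟪b i, v⟫_ℂ) := by
      funext i
      rw [← inner_conj_symm v (b i), ← Complex.normSq_eq_conj_mul_self, Complex.reCLM_apply,
        Complex.ofReal_re, Complex.normSq_eq_norm_sq]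
    rw [h4]
    exact h2
  have hcs : ∀ k, Summable (fun i => ‖F (i, k)‖) ∧ ∑' i, ‖F (i, k)‖ ≤ ‖x k‖ * ‖y k‖ := by
    intro k
    have hF' : (fun i => ‖F (i, k)‖) = fun i => ‖⟪b i, x k⟫_ℂ‖ * ‖⟪b i, y k⟫_ℂ‖ := by
      funext i
      simp only [hF]
      rw [norm_mul, norm_inner_symm]
    have h2 : ∀ z : H, HasSum (fun i => ‖⟪b i, z⟫_ℂ‖ ^ (2 : ℝ)) (‖z‖ ^ 2) := by
      intro z
      simpa [Real.rpow_two] using hsq z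
    have h3 := Real.inner_le_Lp_mul_Lq_tsum_of_nonneg Real.HolderConjugate.two_two
      (fun i => norm_nonneg ⟪b i, x k⟫_ℂ) (fun i => norm_nonneg ⟪b i, y k⟫_ℂ)
      (h2 (x k)).summable (h2 (y k)).summable
    rw [(h2 (x k)).tsum_eq, (h2 (y k)).tsum_eq, ← Real.sqrt_eq_rpow, ← Real.sqrt_eq_rpow,
      Real.sqrt_sq (norm_nonneg _), Real.sqrt_sq (norm_nonneg _)] at h3
    have h4 := Real.summable_mul_of_Lp_Lq_of_nonneg Real.HolderConjugate.two_two
      (fun i => norm_nonneg ⟪b i, x k⟫_ℂ) (fun i => norm_nonneg ⟪b i, y k⟫_ℂ)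
      (h2 (x k)).summable (h2 (y k)).summable
    rw [hF']
    exact ⟨h4, h3⟩
  have hsum : Summable F := by
    refine Summable.of_norm ?_
    rw [← (Equiv.prodComm ℕ ι).summable_iff]
    refine (summable_prod_of_nonneg fun q => norm_nonneg _).2 ⟨fun k => (hcs k).1, ?_⟩
    exact Summable.of_nonneg_of_le (fun k => tsum_nonneg fun i => norm_nonneg _)
      (fun k => (hcs k).2) hxy
  have hk : ∀ k, HasSum (fun i => F (i, k)) ⟪x k, y k⟫_ℂ := fun k =>
    b.hasSum_inner_mul_inner (x k) (y k)
  have hi : ∀ i, HasSum (fun k => F (i, k)) ⟪b i, A (b i)⟫_ℂ := by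
    intro i
    have h1 := (innerSL ℂ (b i)).hasSum (hA (b i))
    simpa [hF, inner_smul_right] using h1
  have h1 := hsum.hasSum.prod_fiberwise hi
  have h2 := ((Equiv.prodComm ι ℕ).symm.hasSum_iff.2 hsum.hasSum).prod_fiberwise hk
  rw [h2.tsum_eq]
  exact h1

theorem IsTraceClass.hasSum_trace {A : H →L[ℂ] H} (hA : IsTraceClass A)
    {ι : Type*} (b : HilbertBasis ι ℂ H) :
    HasSum (fun i => ⟪b i, A (b i)⟫_ℂ) (trace A) := by
  obtain ⟨x, y, hxy, h⟩ := hA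
  have h1 := hasSum_inner_basis hxy h b
  have h2 := hasSum_inner_basis hxy h (exists_hilbertBasis ℂ H).choose_spec.choose
  rw [trace, h2.tsum_eq]
  exact h1

end Trace

/-! ### Truncated Toeplitz operators -/

/-- The Fourier transform `∫ exp (i x t) f x dx`. -/
def fourierHat (f : ℝ → ℝ) (t : ℝ) : ℂ :=
  ∫ x : ℝ, Complex.exp (Complex.I * x * t) * (f x : ℂ)

theorem norm_fourierHat_le (f : ℝ → ℝ) (t : ℝ) : ‖fourierHat f t‖ ≤ ∫ x : ℝ, |f x| := by
  refine (norm_integral_le_integral_norm _).trans (le_of_eq ?_)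
  congr 1
  funext x
  rw [norm_mul, Complex.norm_exp]
  simp

theorem continuous_fourierHat (f : ℝ → ℝ) : Continuous (fourierHat f) := by
  by_cases hf : Integrable f
  · refine continuous_of_dominated (bound := fun x => |f x|) ?_ ?_ hf.abs ?_
    · intro t
      exact (by fun_prop : Continuous fun x : ℝ =>
        Complex.exp (Complex.I * x * t)).aestronglyMeasurable.mul
          (Complex.continuous_ofReal.comp_aestronglyMeasurable hf.1)
    · intro t
      refine ae_of_all _ fun x => ?_
      rw [norm_mul, Complex.norm_exp]
      simp
    · exact ae_of_all _ fun x => by fun_prop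
  · have h0 : fourierHat f = fun _ => 0 := by
      funext t
      refine integral_undef fun hi => hf ?_
      have h1 := hi.norm
      have h2 : (fun x : ℝ => ‖Complex.exp (Complex.I * x * t) * (f x : ℂ)‖)
          = fun x => |f x| := by
        funext x
        rw [norm_mul, Complex.norm_exp]
        simp
      have h3 : AEStronglyMeasurable f volume := by
        have h4 := ((by fun_prop : Continuous fun x : ℝ =>
          Complex.exp (-(Complex.I * x * t))).aestronglyMeasurable (μ := volume)).mul hi.1
        have h5 := Complex.continuous_re.comp_aestronglyMeasurable h4
        refine h5.congr (ae_of_all _ fun x => ?_)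
        simp only [Pi.mul_apply]
        rw [← mul_assoc, ← Complex.exp_add]
        simp
      rw [h2] at h1
      exact (integrable_norm_iff h3).1 h1
    rw [h0]
    exact continuous_const

/-- The complex Hilbert space `L²[0,T]`. -/
abbrev L2 (T : ℝ) : Type := Lp ℂ 2 (volume.restrict (Set.Icc (0 : ℝ) T))

theorem L2.integrable {T : ℝ} (u : L2 T) :
    Integrable u (volume.restrict (Set.Icc (0 : ℝ) T)) :=
  (Lp.memLp u).integrable (by norm_num)

theorem integrable_kernel_mul (f : ℝ → ℝ) {T : ℝ} (u : L2 T) (t : ℝ) :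
    Integrable (fun s => fourierHat f (t - s) * u s) (volume.restrict (Set.Icc (0 : ℝ) T)) :=
  (L2.integrable u).bdd_mul (c := ∫ x : ℝ, |f x|)
    ((continuous_fourierHat f).comp (by fun_prop : Continuous fun s : ℝ =>
      t - s)).aestronglyMeasurable
    (ae_of_all _ fun s => norm_fourierHat_le f _)

theorem continuous_kernel_integral (f : ℝ → ℝ) {T : ℝ} (u : L2 T) :
    Continuous fun t : ℝ => ∫ s in Set.Icc (0 : ℝ) T, fourierHat f (t - s) * u s := by
  refine continuous_of_dominated (bound := fun s => (∫ x : ℝ, |f x|) * ‖u s‖) ?_ ?_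
    ((L2.integrable u).norm.const_mul _) ?_
  · exact fun t => (integrable_kernel_mul f u t).1
  · intro t
    refine ae_of_all _ fun s => ?_
    rw [norm_mul]
    exact mul_le_mul_of_nonneg_right (norm_fourierHat_le f _) (norm_nonneg _)
  · exact ae_of_all _ fun s => ((continuous_fourierHat f).comp
      (by fun_prop : Continuous fun t : ℝ => t - s)).mul continuous_const

theorem norm_kernel_integral_le (f : ℝ → ℝ) {T : ℝ} (u : L2 T) (t : ℝ) :
    ‖∫ s in Set.Icc (0 : ℝ) T, fourierHat f (t - s) * u s‖ ≤
      (∫ x : ℝ, |f x|) * ∫ s in Set.Icc (0 : ℝ) T, ‖u s‖ := by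
  rw [← integral_const_mul]
  refine norm_integral_le_of_norm_le ((L2.integrable u).norm.const_mul _) ?_
  refine ae_of_all _ fun s => ?_
  rw [norm_mul]
  exact mul_le_mul_of_nonneg_right (norm_fourierHat_le f _) (norm_nonneg _)

theorem memLp_kernel_integral (f : ℝ → ℝ) {T : ℝ} (u : L2 T) :
    MemLp (fun t : ℝ => ∫ s in Set.Icc (0 : ℝ) T, fourierHat f (t - s) * u s) 2
      (volume.restrict (Set.Icc (0 : ℝ) T)) :=
  MemLp.of_bound (continuous_kernel_integral f u).aestronglyMeasurable _
    (ae_of_all _ fun t => norm_kernel_integral_le f u t)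

/-- `[W_T(f) u](t) = ∫_0^T fourierHat f (t - s) u(s) ds` as a linear map on `L²[0,T]`. -/
def toeplitzLin (T : ℝ) (f : ℝ → ℝ) : L2 T →ₗ[ℂ] L2 T where
  toFun u := (memLp_kernel_integral f u).toLp _
  map_add' u v := by
    rw [← MemLp.toLp_add]
    refine MemLp.toLp_congr _ _ (ae_of_all _ fun t => ?_)
    rw [Pi.add_apply, ← integral_add (integrable_kernel_mul f u t) (integrable_kernel_mul f v t)]
    refine integral_congr_ae ?_
    filter_upwards [Lp.coeFn_add u v] with s hs
    rw [hs, Pi.add_apply, mul_add]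
  map_smul' c u := by
    rw [RingHom.id_apply, ← MemLp.toLp_const_smul]
    refine MemLp.toLp_congr _ _ (ae_of_all _ fun t => ?_)
    rw [Pi.smul_apply, ← integral_smul]
    refine integral_congr_ae ?_
    filter_upwards [Lp.coeFn_smul c u] with s hs
    rw [hs, Pi.smul_apply, smul_eq_mul, smul_eq_mul, mul_left_comm]

theorem toeplitzLin_bound (T : ℝ) (f : ℝ → ℝ) :
    ∃ C : ℝ, ∀ u : L2 T, ‖toeplitzLin T f u‖ ≤ C * ‖u‖ := by
  set μ := volume.restrict (Set.Icc (0 : ℝ) T) with hμ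
  have hA : 0 ≤ ∫ x : ℝ, |f x| := integral_nonneg fun x => abs_nonneg _
  obtain ⟨D, hD⟩ : ∃ D : ℝ, ∀ u : L2 T, ∫ s, ‖u s‖ ∂μ ≤ D * ‖u‖ := by
    refine ⟨(μ Set.univ ^ (1 / (1 : ℝ≥0∞).toReal - 1 / (2 : ℝ≥0∞).toReal)).toReal,
      fun u => ?_⟩
    have h1 := eLpNorm_le_eLpNorm_mul_rpow_measure_univ (μ := μ) (p := 1) (q := 2)
      (by norm_num) (Lp.aestronglyMeasurable u)
    have hfin : eLpNorm u 2 μ * μ Set.univ ^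
        (1 / (1 : ℝ≥0∞).toReal - 1 / (2 : ℝ≥0∞).toReal) ≠ ∞ := by
      refine ENNReal.mul_ne_top (Lp.memLp u).2.ne ?_
      exact ENNReal.rpow_ne_top_of_nonneg (by norm_num) (measure_ne_top μ _)
    have h2 := ENNReal.toReal_mono hfin h1
    rw [ENNReal.toReal_mul, ← Lp.norm_def, eLpNorm_one_eq_lintegral_enorm,
      ← integral_norm_eq_lintegral_enorm (Lp.aestronglyMeasurable u)] at h2
    rw [mul_comm]
    exact h2
  refine ⟨μ.real Set.univ ^ (2 : ℝ≥0∞).toReal⁻¹ * ((∫ x : ℝ, |f x|) * D), fun u => ?_⟩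
  have h3 : ‖toeplitzLin T f u‖ ≤ μ.real Set.univ ^ (2 : ℝ≥0∞).toReal⁻¹ *
      ((∫ x : ℝ, |f x|) * (D * ‖u‖)) := by
    refine Lp.norm_le_of_ae_bound ?_ ?_
    · exact mul_nonneg hA ((integral_nonneg fun s => norm_nonneg _).trans (hD u))
    · filter_upwards [MemLp.coeFn_toLp (memLp_kernel_integral f u)] with t ht
      refine (le_of_eq (congrArg norm ht)).trans ?_
      exact (norm_kernel_integral_le f u t).trans (mul_le_mul_of_nonneg_left (hD u) hA)
  refine h3.trans (le_of_eq ?_)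
  ring

/-- The `T`-truncated Toeplitz operator `W_T(f)` generated by `f`, a bounded operator on
`L²[0,T]`. -/
def toeplitz (T : ℝ) (f : ℝ → ℝ) : L2 T →L[ℂ] L2 T :=
  (toeplitzLin T f).mkContinuousOfExistsBound (toeplitzLin_bound T f)

theorem toeplitz_apply_ae (T : ℝ) (f : ℝ → ℝ) (u : L2 T) :
    toeplitz T f u =ᵐ[volume.restrict (Set.Icc (0 : ℝ) T)]
      fun t => ∫ s in Set.Icc (0 : ℝ) T, fourierHat f (t - s) * u s :=
  MemLp.coeFn_toLp (memLp_kernel_integral f u)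

/-- The operator product `W_T(h_0) W_T(h_1) ⋯ W_T(h_n)`, in this order. -/
def toeplitzProd {n : ℕ} (h : Fin (n + 1) → ℝ → ℝ) (T : ℝ) : L2 T →L[ℂ] L2 T :=
  (List.ofFn fun i => toeplitz T (h i)).prod

/-- `S(T) = (1/T) tr (W_T(h_0) ⋯ W_T(h_n))`. -/
def S {n : ℕ} (h : Fin (n + 1) → ℝ → ℝ) (T : ℝ) : ℂ :=
  (1 / (T : ℂ)) * trace (toeplitzProd h T)

/-- `M = (2π)^n ∫ h_0(x) ⋯ h_n(x) dx`; the number of functions is `n + 1`. -/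
def M {n : ℕ} (h : Fin (n + 1) → ℝ → ℝ) : ℝ :=
  (2 * Real.pi) ^ n * ∫ x : ℝ, ∏ i, h i x

/-- The approximation error `Δ(T) = |S(T) - M|`. -/
def Delta {n : ℕ} (h : Fin (n + 1) → ℝ → ℝ) (T : ℝ) : ℝ :=
  ‖S h T - (M h : ℂ)‖

/-- `φ(u) = ∫ h_0(x) h_1(x - u_0) ⋯ h_n(x - u_{n-1}) dx` for `u ∈ ℝⁿ`. For integrable `h_i` the
integral converges absolutely for almost every `u`; at the remaining `u` the value is `0`. -/
def phi {n : ℕ} (h : Fin (n + 1) → ℝ → ℝ) (u : Fin n → ℝ) : ℝ :=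
  ∫ x : ℝ, h 0 x * ∏ i : Fin n, h i.succ (x - u i)

end TruncatedToeplitz

end

noncomputable section

namespace TruncatedToeplitz

/-! Let `e_x(t) = exp (i x t)` in `L²[0,T]`. Weakly, `W_T(f) = ∫ f(x) e_x ⊗ e_x dx`
(`inner_toeplitz`), and `⟪e_a, e_b⟫ = D_T(b - a)` with `D_T` the Dirichlet kernel. Multiplying such
operators and taking the trace gives an integral over closed paths of frequencies. Moving the base
point to the origin turns it into `S(T) = ∫ φ(-z) K_T(z) dz` (`S_eq_integral_phi`), where `K_T(z)`
is `1/T` times the product of `D_T` over the increments of the loop `0, z, 0`. Since `M = (2π)^n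
φ(0)`, it has to be shown that `K_T` is an approximate identity of mass `(2π)^n`.

The mass comes from `D_1 * D_1 = 2π D_1` (`integral_dirichlet_mul`). For bounded `φ` the
substitution `z → z/T` and dominated convergence suffice
(`tendsto_integral_mul_prod_dirichlet_of_bounded`). For unbounded `φ` in `L^m`, `m = n - 1`, the
excess over a high level lives off a ball around `0`, by continuity there. A loop leaving the ball
has two long increments, which cost two factors `T`; this bounds `K_T` off the ball in the conjugate
space of `L^m`, uniformly in `T` (`exists_lintegral_mul_prod_dirichlet_steps_le`). This settles the
condition on `φ`.

The Hölder condition reduces to it: with exponents lowered until their inverses sum to one, `φ` is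
bounded and continuous at `0` (`continuousAt_phi`), and it is always integrable, so it lies in
`L^m`.

The trace class property (`isTraceClass_toeplitz_mul`) holds because all `e_x` are absolutely
convergent combinations of one fixed sequence of vectors, with bounds uniform in `x`. -/

/-! ### Increments of a polygonal path -/

/-- The increments of the path `a, y 0, …, y (n - 1), b`. -/
def steps : {n : ℕ} → ℝ → (Fin n → ℝ) → ℝ → Fin (n + 1) → ℝ
  | 0, a, _, b => fun _ => b - a
  | _ + 1, a, y, b => Fin.cons (y 0 - a) (steps (y 0) (Fin.tail y) b)

@[simp] theorem steps_zero_dim (a b : ℝ) (y : Fin 0 → ℝ) (k : Fin 1) : steps a y b k = b - a := rfl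

@[simp] theorem steps_cons_zero {n : ℕ} (a b x : ℝ) (y : Fin n → ℝ) :
    steps a (Fin.cons x y : Fin (n + 1) → ℝ) b 0 = x - a := rfl

@[simp] theorem steps_cons_succ {n : ℕ} (a b x : ℝ) (y : Fin n → ℝ) (k : Fin (n + 1)) :
    steps a (Fin.cons x y : Fin (n + 1) → ℝ) b k.succ = steps x y b k := rfl

theorem continuous_steps {n : ℕ} (k : Fin (n + 1)) :
    Continuous fun q : ℝ × (Fin n → ℝ) × ℝ => steps q.1 q.2.1 q.2.2 k := by
  induction n with
  | zero => simp only [steps_zero_dim]; fun_prop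
  | succ n ih =>
    refine Fin.cases ?_ (fun j => ?_) k
    · change Continuous fun q : ℝ × (Fin (n + 1) → ℝ) × ℝ => q.2.1 0 - q.1
      fun_prop
    · change Continuous fun q : ℝ × (Fin (n + 1) → ℝ) × ℝ =>
        steps (q.2.1 0) (Fin.tail q.2.1) q.2.2 j
      have h : Continuous fun q : ℝ × (Fin (n + 1) → ℝ) × ℝ =>
          ((q.2.1 0, Fin.tail q.2.1, q.2.2) : ℝ × (Fin n → ℝ) × ℝ) := by
        unfold Fin.tail
        fun_prop
      exact (ih j).comp h

theorem continuous_steps_path {n : ℕ} (a b : ℝ) (k : Fin (n + 1)) :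
    Continuous fun y : Fin n → ℝ => steps a y b k :=
  (continuous_steps k).comp (by fun_prop : Continuous fun y : Fin n → ℝ => (a, y, b))

theorem sum_steps {n : ℕ} (a b : ℝ) (y : Fin n → ℝ) : ∑ k, steps a y b k = b - a := by
  induction n generalizing a with
  | zero => simp
  | succ n ih =>
    rw [← Fin.cons_self_tail y, Fin.sum_univ_succ]
    simp only [steps_cons_zero, steps_cons_succ, ih]
    ring

theorem steps_smul {n : ℕ} (c a b : ℝ) (y : Fin n → ℝ) (k : Fin (n + 1)) :
    steps (c * a) (c • y) (c * b) k = c * steps a y b k := by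
  induction n generalizing a with
  | zero => simp [mul_sub]
  | succ n ih =>
    refine Fin.cases ?_ (fun j => ?_) k
    · change c * y 0 - c * a = c * (y 0 - a)
      ring
    · exact ih (y 0) (Fin.tail y) j

theorem steps_const_add {n : ℕ} (c a b : ℝ) (y : Fin n → ℝ) (k : Fin (n + 1)) :
    steps (c + a) (fun i => c + y i) (c + b) k = steps a y b k := by
  induction n generalizing a with
  | zero => simp
  | succ n ih =>
    refine Fin.cases ?_ (fun j => ?_) k
    · change c + y 0 - (c + a) = y 0 - a
      ring
    · exact ih (y 0) (Fin.tail y) j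

theorem abs_path_sub_le {n : ℕ} (a b : ℝ) (y : Fin n → ℝ) (i : Fin n) :
    |y i - a| ≤ ∑ k, |steps a y b k| := by
  induction n generalizing a with
  | zero => exact i.elim0
  | succ n ih =>
    rw [Fin.sum_univ_succ]
    have h0 : |steps a y b 0| = |y 0 - a| := rfl
    have hs : ∀ k : Fin (n + 1), steps a y b k.succ = steps (y 0) (Fin.tail y) b k := fun k => rfl
    simp only [hs, h0]
    refine Fin.cases ?_ (fun j => ?_) i
    · exact le_add_of_nonneg_right (Finset.sum_nonneg fun k _ => abs_nonneg _)
    · have h1 := ih (y 0) (Fin.tail y) j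
      have h2 : y j.succ - a = (y 0 - a) + (Fin.tail y j - y 0) := by
        simp only [Fin.tail]; ring
      rw [h2]
      exact (abs_add_le _ _).trans (by gcongr)

/-- A loop based at `0` that leaves the `δ`-ball has at least two long increments. -/
theorem exists_two_long_steps {n : ℕ} {δ : ℝ} (hδ : 0 < δ) (y : Fin n → ℝ) (hy : δ ≤ ‖y‖) :
    ∃ (i : Fin (n + 1)) (j : Fin n), δ / (n + 1) ^ 2 ≤ |steps 0 y 0 i| ∧
      δ / (n + 1) ^ 2 ≤ |steps 0 y 0 (i.succAbove j)| := by
  set δ' := δ / ((n : ℝ) + 1) ^ 2 with hδ'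
  have hδ'0 : 0 < δ' := by positivity
  by_contra! hcon
  -- Take `i` the longest increment. If no second one is long, all others are short; the increments
  -- of a loop sum to zero, so the longest is at most `n δ'`. Every vertex is then within `2 n δ' <
  -- (n + 1)² δ' = δ` of the origin.
  obtain ⟨i, hi⟩ := Finite.exists_max fun k => |steps 0 y 0 k|
  have hn : 0 < n := by
    rcases Nat.eq_zero_or_pos n with h | h
    · subst h
      rw [Subsingleton.elim y 0, norm_zero] at hy
      exact absurd hy (not_le.2 hδ)
    · exact h
  have hlt : ∀ j : Fin n, |steps 0 y 0 (i.succAbove j)| < δ' := by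
    intro j
    by_cases h : δ' ≤ |steps 0 y 0 i|
    · exact hcon i j h
    · exact (hi _).trans_lt (not_le.1 h)
  have hsum := sum_steps 0 0 y
  rw [Fin.sum_univ_succAbove _ i, sub_zero] at hsum
  have hsub : ∑ j : Fin n, |steps 0 y 0 (i.succAbove j)| ≤ n * δ' := by
    refine (Finset.sum_le_sum fun j _ => (hlt j).le).trans ?_
    simp
  have hbig : |steps 0 y 0 i| ≤ n * δ' := by
    rw [eq_neg_of_add_eq_zero_left hsum, abs_neg]
    exact (Finset.abs_sum_le_sum_abs _ _).trans hsub
  have hlt2 : ‖y‖ < δ := by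
    rw [pi_norm_lt_iff hδ]
    intro k
    have h1 := abs_path_sub_le 0 0 y k
    rw [sub_zero, Fin.sum_univ_succAbove _ i] at h1
    have h2 : δ = (n + 1) ^ 2 * δ' := by
      rw [hδ']; field_simp
    have h3 : (1 : ℝ) ≤ n := by exact_mod_cast hn
    rw [Real.norm_eq_abs, h2]
    nlinarith
  exact absurd hy (not_le.2 hlt2)

/-! ### Integration over paths -/

theorem measurePreserving_cons (n : ℕ) :
    MeasurePreserving (fun q : ℝ × (Fin n → ℝ) => (Fin.cons q.1 q.2 : Fin (n + 1) → ℝ)) := by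
  have h := (volume_preserving_piFinSuccAbove (fun _ : Fin (n + 1) => ℝ) 0).symm
  convert! h using 1
  funext q
  simp [MeasurableEquiv.piFinSuccAbove_symm_apply, Fin.insertNthEquiv]

theorem measurableEmbedding_cons (n : ℕ) :
    MeasurableEmbedding (fun q : ℝ × (Fin n → ℝ) => (Fin.cons q.1 q.2 : Fin (n + 1) → ℝ)) := by
  have h := (MeasurableEquiv.piFinSuccAbove (fun _ : Fin (n + 1) => ℝ) 0).symm.measurableEmbedding
  convert! h using 1
  funext q
  simp [MeasurableEquiv.piFinSuccAbove_symm_apply, Fin.insertNthEquiv]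

theorem lintegral_fin_succ {n : ℕ} {F : (Fin (n + 1) → ℝ) → ℝ≥0∞} (hF : Measurable F) :
    ∫⁻ y, F y = ∫⁻ x : ℝ, ∫⁻ y : Fin n → ℝ, F (Fin.cons x y) := by
  have h := measurePreserving_cons n
  rw [← h.lintegral_comp hF, Measure.volume_eq_prod, lintegral_prod]
  exact (hF.comp h.measurable).aemeasurable

theorem integrable_fin_succ_iff {n : ℕ} {E : Type*} [NormedAddCommGroup E]
    {F : (Fin (n + 1) → ℝ) → E} :
    Integrable (fun q : ℝ × (Fin n → ℝ) => F (Fin.cons q.1 q.2)) ↔ Integrable F :=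
  (measurePreserving_cons n).integrable_comp_emb (measurableEmbedding_cons n)

theorem integral_fin_succ {n : ℕ} {F : (Fin (n + 1) → ℝ) → ℂ} (hF : Integrable F) :
    ∫ y, F y = ∫ x : ℝ, ∫ y : Fin n → ℝ, F (Fin.cons x y) := by
  rw [← (measurePreserving_cons n).integral_comp (measurableEmbedding_cons n),
    Measure.volume_eq_prod, integral_prod]
  exact integrable_fin_succ_iff.2 hF

theorem volume_fin_zero : (volume : Measure (Fin 0 → ℝ)) = Measure.dirac 0 := by
  rw [volume_pi, Measure.pi_of_empty _ 0]

theorem measurable_prod_steps {n : ℕ} {F : Fin (n + 1) → ℝ → ℝ≥0∞} (hF : ∀ k, Measurable (F k)) :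
    Measurable fun q : ℝ × (Fin n → ℝ) × ℝ => ∏ k, F k (steps q.1 q.2.1 q.2.2 k) :=
  Finset.measurable_fun_prod _ fun k _ => (hF k).comp (continuous_steps k).measurable

/-- With the starting point free, all `n + 1` increments are independent coordinates: integrating
over `a` first, for a fixed first vertex, splits off the first factor. -/
theorem lintegral_lintegral_prod_steps {n : ℕ} {F : Fin (n + 1) → ℝ → ℝ≥0∞}
    (hF : ∀ k, Measurable (F k)) (b : ℝ) :
    ∫⁻ a, ∫⁻ y : Fin n → ℝ, ∏ k, F k (steps a y b k) = ∏ k, ∫⁻ x, F k x := by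
  induction n with
  | zero =>
    simp only [steps_zero_dim, volume_fin_zero, lintegral_dirac, Fin.prod_univ_succ,
      Fin.prod_univ_zero, mul_one]
    exact lintegral_sub_left_eq_self (μ := volume) (F 0) b
  | succ n ih =>
    have hm : Measurable fun q : ℝ × (Fin (n + 1) → ℝ) => ∏ k, F k (steps q.1 q.2 b k) :=
      (measurable_prod_steps hF).comp
        (by fun_prop : Measurable fun q : ℝ × (Fin (n + 1) → ℝ) => (q.1, q.2, b))
    have hm' : Measurable fun q : ℝ × (Fin n → ℝ) => ∏ k, F (Fin.succ k) (steps q.1 q.2 b k) :=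
      (measurable_prod_steps fun k => hF (Fin.succ k)).comp
        (by fun_prop : Measurable fun q : ℝ × (Fin n → ℝ) => (q.1, q.2, b))
    have h1 : ∀ a, ∫⁻ y : Fin (n + 1) → ℝ, ∏ k, F k (steps a y b k)
        = ∫⁻ x, F 0 (x - a) * ∫⁻ y : Fin n → ℝ, ∏ k, F (Fin.succ k) (steps x y b k) := by
      intro a
      have hma : Measurable fun y : Fin (n + 1) → ℝ => ∏ k, F k (steps a y b k) :=
        hm.comp (by fun_prop : Measurable fun y : Fin (n + 1) → ℝ => (a, y))
      rw [lintegral_fin_succ hma]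
      refine lintegral_congr fun x => ?_
      have hmx : Measurable fun y : Fin n → ℝ => ∏ k, F (Fin.succ k) (steps x y b k) :=
        hm'.comp (by fun_prop : Measurable fun y : Fin n → ℝ => (x, y))
      rw [← lintegral_const_mul _ hmx]
      refine lintegral_congr fun y => ?_
      simp [Fin.prod_univ_succ]
    simp only [h1]
    rw [lintegral_lintegral_swap]
    · rw [Fin.prod_univ_succ, ← ih (fun k => hF k.succ),
        ← lintegral_const_mul _ hm'.lintegral_prod_right']
      refine lintegral_congr fun x => ?_
      rw [lintegral_mul_const (f := fun a => F 0 (x - a)) _ ((hF 0).comp (by fun_prop)),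
        lintegral_sub_left_eq_self (F 0) x]
    · refine Measurable.aemeasurable ?_
      exact ((hF 0).comp (by fun_prop : Measurable fun q : ℝ × ℝ => q.2 - q.1)).mul
        (hm'.lintegral_prod_right'.comp measurable_snd)

/-- All increments but one are coordinates on the space of paths with fixed ends. -/
theorem lintegral_prod_steps_succAbove {n : ℕ} {F : Fin n → ℝ → ℝ≥0∞}
    (hF : ∀ k, Measurable (F k)) (i : Fin (n + 1)) (a b : ℝ) :
    ∫⁻ y : Fin n → ℝ, ∏ k, F k (steps a y b (i.succAbove k)) = ∏ k, ∫⁻ x, F k x := by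
  induction n generalizing a with
  | zero => simp [volume_fin_zero]
  | succ n ih =>
    have hm : Measurable fun y : Fin (n + 1) → ℝ => ∏ k, F k (steps a y b (i.succAbove k)) :=
      Finset.measurable_fun_prod _ fun k _ =>
        (hF k).comp (continuous_steps_path a b _).measurable
    rw [lintegral_fin_succ hm]
    refine Fin.cases ?_ (fun j => ?_) i
    -- With the first increment omitted, the first vertex acts as a free starting point of the
    -- remaining path.
    · simp only [Fin.zero_succAbove, steps_cons_succ]
      exact lintegral_lintegral_prod_steps hF b
    · have h1 : ∀ x : ℝ, ∫⁻ y : Fin n → ℝ,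
          ∏ k, F k (steps a (Fin.cons x y : Fin (n + 1) → ℝ) b (j.succ.succAbove k))
          = F 0 (x - a) * ∏ k : Fin n, ∫⁻ x, F k.succ x := by
        intro x
        rw [← ih (fun k => hF k.succ) j x, ← lintegral_const_mul _
          (Finset.measurable_fun_prod _ fun k _ =>
            (hF k.succ).comp (continuous_steps_path x b _).measurable)]
        refine lintegral_congr fun y => ?_
        simp [Fin.prod_univ_succ]
      simp only [h1]
      rw [lintegral_mul_const (f := fun x => F 0 (x - a)) _ ((hF 0).comp (by fun_prop)),
        lintegral_sub_right_eq_self (F 0) a,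
        Fin.prod_univ_succ]

theorem integrable_prod_steps_succAbove {n : ℕ} {f : Fin n → ℝ → ℝ}
    (hc : ∀ k, Continuous (f k)) (hf : ∀ k, Integrable (f k)) (i : Fin (n + 1)) (a b : ℝ) :
    Integrable fun y : Fin n → ℝ => ∏ k, f k (steps a y b (i.succAbove k)) := by
  refine ⟨(continuous_finsetProd _ fun k _ =>
    (hc k).comp (continuous_steps_path a b _)).aestronglyMeasurable, ?_⟩
  have h := lintegral_prod_steps_succAbove (F := fun k x => ‖f k x‖ₑ)
    (fun k => (hc k).enorm.measurable) i a b
  rw [HasFiniteIntegral]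
  simp only [enorm_eq_nnnorm, nnnorm_prod, ENNReal.ofNNReal_finsetProd] at h ⊢
  rw [h]
  exact ENNReal.prod_lt_top fun k _ => (hf k).2

/-- The smallest of the `n + 1` factors is shared out, as `n` equal roots, among the others. There
are only `n` free coordinates for `n + 1` increments; the gain `1 / n` in the exponent makes the
weight `(1 + |x|)⁻¹`, itself not integrable, integrable in each coordinate. -/
theorem prod_le_sum_prod_succAbove_rpow {n : ℕ} (hn : 0 < n) {a : Fin (n + 1) → ℝ}
    (ha : ∀ k, 0 ≤ a k) :
    ∏ k, a k ≤ ∑ i : Fin (n + 1), ∏ k : Fin n, a (i.succAbove k) ^ (1 + 1 / (n : ℝ)) := by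
  have hn' : (n : ℝ) ≠ 0 := by positivity
  obtain ⟨i, hi⟩ := Finite.exists_min a
  refine le_trans ?_ (Finset.single_le_sum (f := fun i : Fin (n + 1) =>
    ∏ k : Fin n, a (i.succAbove k) ^ (1 + 1 / (n : ℝ)))
    (fun i _ => Finset.prod_nonneg fun k _ => Real.rpow_nonneg (ha _) _) (Finset.mem_univ i))
  rw [Fin.prod_univ_succAbove _ i]
  have h1 : ∀ k : Fin n, a (i.succAbove k) ^ (1 + 1 / (n : ℝ))
      = a (i.succAbove k) ^ (1 / (n : ℝ)) * a (i.succAbove k) := by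
    intro k
    rw [add_comm, Real.rpow_add' (ha _) (by positivity), Real.rpow_one]
  simp only [h1]
  rw [Finset.prod_mul_distrib]
  refine mul_le_mul_of_nonneg_right ?_ (Finset.prod_nonneg fun k _ => ha _)
  calc a i = ∏ _k : Fin n, a i ^ (1 / (n : ℝ)) := by
        rw [Finset.prod_const, Finset.card_univ, Fintype.card_fin, ← Real.rpow_natCast,
          ← Real.rpow_mul (ha i), one_div_mul_cancel hn', Real.rpow_one]
    _ ≤ _ := Finset.prod_le_prod (fun k _ => Real.rpow_nonneg (ha i) _) fun k _ =>
        Real.rpow_le_rpow (ha i) (hi _) (by positivity)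

theorem integrable_one_add_abs_inv_rpow {r : ℝ} (hr : 1 < r) :
    Integrable fun x : ℝ => ((1 + |x|)⁻¹) ^ r := by
  have h := integrable_one_add_norm (E := ℝ) (μ := volume) (r := r) (by simpa using hr)
  refine h.congr (ae_of_all _ fun x => ?_)
  simp only [Real.norm_eq_abs]
  rw [Real.inv_rpow (by positivity), Real.rpow_neg (by positivity)]

theorem continuous_one_add_abs_inv : Continuous fun x : ℝ => (1 + |x|)⁻¹ :=
  Continuous.inv₀ (by fun_prop) fun x => by positivity

theorem integrable_prod_one_add_abs_steps {n : ℕ} (a b : ℝ) :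
    Integrable fun y : Fin n → ℝ => ∏ k, (1 + |steps a y b k|)⁻¹ := by
  rcases Nat.eq_zero_or_pos n with rfl | hn
  · have : IsFiniteMeasure (volume : Measure (Fin 0 → ℝ)) := by
      rw [volume_fin_zero]; infer_instance
    simp
  · have hr : 1 < 1 + 1 / (n : ℝ) := by
      have : 0 < 1 / (n : ℝ) := by positivity
      linarith
    refine Integrable.mono' (integrable_finsetSum Finset.univ fun i _ =>
      integrable_prod_steps_succAbove (f := fun _ x => ((1 + |x|)⁻¹) ^ (1 + 1 / (n : ℝ)))
        (fun _ => continuous_one_add_abs_inv.rpow_const fun _ => Or.inr (by linarith))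
        (fun _ => integrable_one_add_abs_inv_rpow hr) i a b) ?_ (ae_of_all _ fun y => ?_)
    · exact (continuous_finsetProd _ fun k _ =>
        continuous_one_add_abs_inv.comp (continuous_steps_path a b k)).aestronglyMeasurable
    · have hp : ∀ k, 0 ≤ (1 + |steps a y b k|)⁻¹ := fun k => by positivity
      rw [Real.norm_of_nonneg (Finset.prod_nonneg fun k _ => hp k)]
      exact prod_le_sum_prod_succAbove_rpow hn hp

/-! ### The Dirichlet kernel `∫_0^T exp (i x t) dt` -/

/-- The kernel `∫_0^T exp (i x t) dt`. -/
def dirichlet (T x : ℝ) : ℂ := ∫ t in Set.Icc (0 : ℝ) T, Complex.exp (Complex.I * x * t)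

theorem norm_exp_I_mul_mul (x t : ℝ) : ‖Complex.exp (Complex.I * x * t)‖ = 1 := by
  rw [Complex.norm_exp]; simp

theorem continuous_dirichlet (T : ℝ) : Continuous (dirichlet T) := by
  refine continuous_of_dominated (bound := fun _ => 1) ?_ ?_ (integrable_const _) ?_
  · exact fun x => (by fun_prop : Continuous fun t : ℝ =>
      Complex.exp (Complex.I * x * t)).aestronglyMeasurable
  · exact fun x => ae_of_all _ fun t => (norm_exp_I_mul_mul x t).le
  · exact ae_of_all _ fun t => by fun_prop

theorem norm_dirichlet_le {T : ℝ} (hT : 0 ≤ T) (x : ℝ) : ‖dirichlet T x‖ ≤ T := by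
  have h := norm_setIntegral_le_of_norm_le_const (μ := volume) (s := Set.Icc (0 : ℝ) T)
    (C := 1) (f := fun t : ℝ => Complex.exp (Complex.I * x * t)) (by simp)
    (fun t _ => (norm_exp_I_mul_mul x t).le)
  simpa [dirichlet, hT] using h

theorem dirichlet_zero {T : ℝ} (hT : 0 ≤ T) : dirichlet T 0 = T := by
  simp [dirichlet, hT]

theorem dirichlet_eq_intervalIntegral {T : ℝ} (hT : 0 ≤ T) (x : ℝ) :
    dirichlet T x = ∫ t in (0 : ℝ)..T, Complex.exp (Complex.I * x * t) := by
  rw [dirichlet, intervalIntegral.integral_of_le hT, integral_Icc_eq_integral_Ioc]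

theorem abs_mul_norm_dirichlet_le {T : ℝ} (hT : 0 ≤ T) (x : ℝ) : |x| * ‖dirichlet T x‖ ≤ 2 := by
  rcases eq_or_ne x 0 with rfl | hx
  · simp
  · have hc : Complex.I * x ≠ 0 := by simp [hx]
    rw [dirichlet_eq_intervalIntegral hT, integral_exp_mul_complex hc, norm_div]
    have h1 : ‖Complex.I * (x : ℂ)‖ = |x| := by simp
    rw [h1, mul_div_cancel₀ _ (abs_ne_zero.2 hx)]
    refine (norm_sub_le _ _).trans ?_
    rw [norm_exp_I_mul_mul, norm_exp_I_mul_mul]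
    norm_num

/-- Adding the bound `T` to `T` times the bound `2` for `|x| ‖dirichlet T x‖` gives the constant `3
T`. -/
theorem norm_dirichlet_le_mul_inv {T : ℝ} (hT : 0 ≤ T) (x : ℝ) :
    ‖dirichlet T x‖ ≤ 3 * T * (1 + |T * x|)⁻¹ := by
  rw [← div_eq_mul_inv, le_div_iff₀ (by positivity), abs_mul, abs_of_nonneg hT]
  nlinarith [abs_mul_norm_dirichlet_le hT x, norm_dirichlet_le hT x, norm_nonneg (dirichlet T x),
    mul_le_mul_of_nonneg_left (abs_mul_norm_dirichlet_le hT x) hT]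

theorem dirichlet_eq_mul_dirichlet_one {T : ℝ} (hT : 0 < T) (x : ℝ) :
    dirichlet T x = T * dirichlet 1 (T * x) := by
  rw [dirichlet_eq_intervalIntegral hT.le, dirichlet_eq_intervalIntegral zero_le_one]
  have h := intervalIntegral.integral_comp_mul_left (a := 0) (b := 1)
    (fun t : ℝ => Complex.exp (Complex.I * x * t)) hT.ne'
  simp only [mul_zero, mul_one] at h
  have h2 : ∀ t : ℝ, Complex.exp (Complex.I * ((T * x : ℝ) : ℂ) * t)
      = Complex.exp (Complex.I * x * ((T * t : ℝ) : ℂ)) := by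
    intro t; push_cast; ring_nf
  simp only [h2, h]
  rw [Complex.real_smul, ← mul_assoc]
  push_cast
  rw [mul_inv_cancel₀ (by exact_mod_cast hT.ne'), one_mul]

theorem continuous_dirichlet_mul (a b : ℝ) :
    Continuous fun y : ℝ => dirichlet 1 (b - y) * dirichlet 1 (y - a) :=
  ((continuous_dirichlet 1).comp (by fun_prop)).mul ((continuous_dirichlet 1).comp (by fun_prop))

theorem integrable_dirichlet_mul (a b : ℝ) :
    Integrable fun y : ℝ => dirichlet 1 (b - y) * dirichlet 1 (y - a) := by
  have hw := integrable_one_add_abs_inv_rpow (r := 2) (by norm_num)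
  refine Integrable.mono' (((hw.comp_sub_left b).add (hw.comp_sub_right a)).const_mul 9)
    (continuous_dirichlet_mul a b).aestronglyMeasurable (ae_of_all _ fun y => ?_)
  have h1 := norm_dirichlet_le_mul_inv zero_le_one (b - y)
  have h2 := norm_dirichlet_le_mul_inv zero_le_one (y - a)
  rw [one_mul] at h1 h2
  have h3 : (0 : ℝ) ≤ (1 + |b - y|)⁻¹ := by positivity
  have h4 : (0 : ℝ) ≤ (1 + |y - a|)⁻¹ := by positivity
  rw [norm_mul]
  simp only [Pi.add_apply, Real.rpow_two]
  refine (mul_le_mul h1 h2 (norm_nonneg _) (by positivity)).trans ?_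
  nlinarith [sq_nonneg ((1 + |b - y|)⁻¹ - (1 + |y - a|)⁻¹)]

/-- The exponential with frequency `a` on the unit interval. -/
def windowExp (a t : ℝ) : ℂ :=
  (Set.Icc (0 : ℝ) 1).indicator (fun t : ℝ => Complex.exp (Complex.I * a * t)) t

theorem integrable_windowExp (a : ℝ) : Integrable (windowExp a) := by
  have h : IntegrableOn (fun t : ℝ => Complex.exp (Complex.I * a * t)) (Set.Icc (0 : ℝ) 1) :=
    (by fun_prop : Continuous fun t : ℝ => Complex.exp (Complex.I * a * t)).integrableOn_Icc
  exact h.integrable_indicator measurableSet_Icc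

theorem norm_windowExp_le (a t : ℝ) : ‖windowExp a t‖ ≤ 1 := by
  unfold windowExp
  refine (norm_indicator_le_norm_self _ _).trans (norm_exp_I_mul_mul a t).le

open FourierTransform in
theorem fourier_windowExp (a w : ℝ) :
    𝓕 (windowExp a) w = dirichlet 1 (a - 2 * Real.pi * w) := by
  rw [Real.fourier_real_eq_integral_exp_smul, dirichlet, ← integral_indicator measurableSet_Icc]
  refine integral_congr_ae (ae_of_all _ fun t => ?_)
  simp only [windowExp, smul_eq_mul]
  by_cases ht : t ∈ Set.Icc (0 : ℝ) 1
  · rw [Set.indicator_of_mem ht, Set.indicator_of_mem ht, ← Complex.exp_add]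
    congr 1
    push_cast
    ring
  · rw [Set.indicator_of_notMem ht, Set.indicator_of_notMem ht, mul_zero]

open FourierTransform in
theorem fourier_windowExp_neg (a w : ℝ) :
    𝓕 (fun t => windowExp (-a) (-t)) w = dirichlet 1 (2 * Real.pi * w - a) := by
  have h := fourier_windowExp (-a) (-w)
  rw [Real.fourier_real_eq_integral_exp_smul] at h ⊢
  rw [← integral_neg_eq_self] at h
  have h2 : 2 * Real.pi * w - a = -a - 2 * Real.pi * -w := by ring
  rw [h2, ← h]
  refine integral_congr_ae (ae_of_all _ fun t => ?_)
  simp only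
  congr 3
  ring_nf

open FourierTransform ContinuousLinearMap in
/-- The Dirichlet kernel reproduces itself under convolution. -/
theorem integral_dirichlet_mul (a b : ℝ) :
    ∫ y : ℝ, dirichlet 1 (b - y) * dirichlet 1 (y - a) = 2 * Real.pi * dirichlet 1 (b - a) := by
  have hpi : (2 * Real.pi) ≠ 0 := by positivity
  -- `f` is the exponential of frequency `b` on `[0,1]`, and `g` that of frequency `a` on `[-1,0]`.
  -- The integrand at `y = 2πw` is the Fourier transform of `f * g` at `w`, so inversion at `0`
  -- gives the integral as `2π (f * g)(0)`.
  set f := windowExp b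
  set g : ℝ → ℂ := fun t => windowExp (-a) (-t) with hg
  have hf : Integrable f := integrable_windowExp b
  have hgi : Integrable g := (integrable_windowExp (-a)).comp_neg
  set h := MeasureTheory.convolution f g (mul ℂ ℂ) volume with hh
  have hF : 𝓕 h = fun w =>
      dirichlet 1 (b - 2 * Real.pi * w) * dirichlet 1 (2 * Real.pi * w - a) := by
    funext w
    rw [hh, Real.fourier_mul_convolution_eq hf hgi, fourier_windowExp, fourier_windowExp_neg]
  have hFi : Integrable (𝓕 h) := by
    rw [hF]
    exact (integrable_dirichlet_mul a b).comp_mul_left' hpi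
  have hhi : Integrable h := hf.integrable_convolution _ hgi
  have hcont : ContinuousAt h 0 := by
    have hdef : h = fun t => ∫ s, f s * g (t - s) := by
      funext t; simp [hh, MeasureTheory.convolution]
    rw [hdef, ContinuousAt]
    refine tendsto_integral_filter_of_dominated_convergence (fun s => ‖f s‖) ?_ ?_ hf.norm ?_
    · exact Eventually.of_forall fun t => hf.1.mul (hgi.comp_sub_left t).1
    · refine Eventually.of_forall fun t => ae_of_all _ fun s => ?_
      rw [norm_mul]
      exact mul_le_of_le_one_right (norm_nonneg _) (norm_windowExp_le _ _)
    -- Pointwise inversion needs continuity of `f * g` at `0`; the jumps of `t ↦ g (t - s)` meet `t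
    -- = 0` only for these two values of `s`.
    · have hne : ∀ᵐ s : ℝ, s ∉ ({0, 1} : Set ℝ) :=
        (measure_eq_zero_iff_ae_notMem.1 (Set.Finite.measure_zero (by simp) volume))
      filter_upwards [hne] with s hs
      simp only [Set.mem_insert_iff, Set.mem_singleton_iff, not_or] at hs
      by_cases hmem : s ∈ Set.Icc (0 : ℝ) 1
      · have h0 : 0 < s := lt_of_le_of_ne hmem.1 (Ne.symm hs.1)
        have h1 : s < 1 := lt_of_le_of_ne hmem.2 hs.2
        refine Tendsto.const_mul _ ?_
        have hev : (fun t : ℝ => g (t - s)) =ᶠ[𝓝 0]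
            fun t => Complex.exp (Complex.I * ((-a : ℝ) : ℂ) * ((-(t - s) : ℝ) : ℂ)) := by
          filter_upwards [Ioo_mem_nhds (show s - 1 < 0 by linarith) h0] with t ht
          simp only [hg, windowExp]
          rw [Set.indicator_of_mem]
          constructor <;> linarith [ht.1, ht.2]
        rw [show g (0 - s) = Complex.exp (Complex.I * ((-a : ℝ) : ℂ) * ((-(0 - s) : ℝ) : ℂ)) from
          hev.eq_of_nhds]
        refine Tendsto.congr' hev.symm ?_
        exact (by fun_prop : Continuous fun t : ℝ =>
          Complex.exp (Complex.I * ((-a : ℝ) : ℂ) * ((-(t - s) : ℝ) : ℂ))).tendsto 0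
      · have hz : f s = 0 := Set.indicator_of_notMem hmem _
        simp [hz]
  have hinv := hhi.fourierInv_fourier_eq hFi hcont
  rw [hF, Real.fourierInv_eq'] at hinv
  simp only [inner_zero_right, mul_zero, Complex.ofReal_zero, zero_mul, Complex.exp_zero,
    one_smul] at hinv
  have hscale := Measure.integral_comp_mul_left
    (fun y : ℝ => dirichlet 1 (b - y) * dirichlet 1 (y - a)) (2 * Real.pi)
  rw [hinv] at hscale
  have hh0 : h 0 = dirichlet 1 (b - a) := by
    simp only [hh, MeasureTheory.convolution, mul_apply']
    rw [dirichlet, ← integral_indicator measurableSet_Icc]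
    refine integral_congr_ae (ae_of_all _ fun t => ?_)
    simp only [f, hg, windowExp, zero_sub, neg_neg]
    by_cases ht : t ∈ Set.Icc (0 : ℝ) 1
    · rw [Set.indicator_of_mem ht, Set.indicator_of_mem ht, Set.indicator_of_mem ht,
        ← Complex.exp_add]
      congr 1
      push_cast
      ring
    · simp only [Set.indicator_of_notMem ht, mul_zero]
  rw [hh0, abs_of_pos (by positivity), Complex.real_smul] at hscale
  rw [hscale]
  push_cast
  field_simp

/-! ### Products of Dirichlet kernels along paths -/

theorem continuous_prod_dirichlet_steps_path {n : ℕ} (T a b : ℝ) :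
    Continuous fun y : Fin n → ℝ => ∏ k, dirichlet T (steps a y b k) :=
  continuous_finsetProd _ fun k _ => (continuous_dirichlet T).comp (continuous_steps_path a b k)

theorem integrable_prod_dirichlet_steps {n : ℕ} (a b : ℝ) :
    Integrable fun y : Fin n → ℝ => ∏ k, dirichlet 1 (steps a y b k) := by
  refine Integrable.mono' ((integrable_prod_one_add_abs_steps a b).const_mul (3 ^ (n + 1)))
    (continuous_prod_dirichlet_steps_path 1 a b).aestronglyMeasurable (ae_of_all _ fun y => ?_)
  rw [norm_prod]
  calc ∏ k, ‖dirichlet 1 (steps a y b k)‖ ≤ ∏ k, 3 * (1 + |steps a y b k|)⁻¹ := by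
        refine Finset.prod_le_prod (fun k _ => norm_nonneg _) fun k _ => ?_
        simpa using norm_dirichlet_le_mul_inv zero_le_one (steps a y b k)
    _ = _ := by rw [Finset.prod_mul_distrib]; simp

/-- Each vertex integrated out merges two kernels into one and contributes a factor `2π`. For `a =
b` this is the mass of the cyclic kernel. -/
theorem integral_prod_dirichlet_steps {n : ℕ} (a b : ℝ) :
    ∫ y : Fin n → ℝ, ∏ k, dirichlet 1 (steps a y b k)
      = (2 * Real.pi) ^ n * dirichlet 1 (b - a) := by
  induction n generalizing a with
  | zero => simp [volume_fin_zero]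
  | succ n ih =>
    rw [integral_fin_succ (integrable_prod_dirichlet_steps a b)]
    have h1 : ∀ x : ℝ, ∫ y : Fin n → ℝ,
        ∏ k, dirichlet 1 (steps a (Fin.cons x y : Fin (n + 1) → ℝ) b k)
        = (2 * Real.pi) ^ n * (dirichlet 1 (b - x) * dirichlet 1 (x - a)) := by
      intro x
      simp only [Fin.prod_univ_succ (n := n + 1), steps_cons_zero, steps_cons_succ]
      rw [integral_const_mul, ih x]
      ring
    simp only [h1]
    rw [integral_const_mul, integral_dirichlet_mul]
    ring

/-- Of the `n + 1` powers of `T`, the Jacobian of the dilation absorbs `n` and the normalisation `1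
/ T` the last. -/
theorem prod_dirichlet_steps_eq {n : ℕ} {T : ℝ} (hT : 0 < T) (y : Fin n → ℝ) :
    ∏ k, dirichlet T (steps 0 y 0 k) = T ^ (n + 1) * ∏ k, dirichlet 1 (steps 0 (T • y) 0 k) := by
  have h : ∀ k, dirichlet T (steps 0 y 0 k) = T * dirichlet 1 (steps 0 (T • y) 0 k) := by
    intro k
    have h1 := steps_smul T 0 0 y k
    rw [mul_zero] at h1
    rw [dirichlet_eq_mul_dirichlet_one hT, h1]
  simp only [h]
  rw [Finset.prod_mul_distrib]
  simp

/-! ### Truncation of functions -/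

/-- The value `x` if `|x| ≤ B`, and `0` otherwise. -/
def trunc (B x : ℝ) : ℝ := if |x| ≤ B then x else 0

theorem measurable_trunc (B : ℝ) : Measurable (trunc B) :=
  Measurable.ite (measurableSet_le (by fun_prop) measurable_const) measurable_id measurable_const

theorem trunc_of_le {B x : ℝ} (h : |x| ≤ B) : trunc B x = x := if_pos h

theorem trunc_of_lt {B x : ℝ} (h : B < |x|) : trunc B x = 0 := if_neg (not_le.2 h)

theorem abs_trunc_le {B : ℝ} (hB : 0 ≤ B) (x : ℝ) : |trunc B x| ≤ B := by
  rcases le_or_gt |x| B with h | h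
  · rwa [trunc_of_le h]
  · simpa [trunc_of_lt h]

theorem abs_trunc_le_abs (B x : ℝ) : |trunc B x| ≤ |x| := by
  rcases le_or_gt |x| B with h | h
  · rw [trunc_of_le h]
  · simp [trunc_of_lt h]

section

variable {α : Type*} [MeasurableSpace α] {μ : Measure α} {g : α → ℝ}

theorem aestronglyMeasurable_trunc (hg : AEStronglyMeasurable g μ) (B : ℝ) :
    AEStronglyMeasurable (fun x => trunc B (g x)) μ :=
  ((measurable_trunc B).comp_aemeasurable hg.aemeasurable).aestronglyMeasurable

theorem memLp_trunc {p : ℝ≥0∞} (hg : MemLp g p μ) (B : ℝ) : MemLp (fun x => trunc B (g x)) p μ :=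
  hg.mono (aestronglyMeasurable_trunc hg.1 B) (ae_of_all _ fun x => abs_trunc_le_abs B (g x))

/-- The case `p = ∞` is included: truncation above the essential supremum changes nothing almost
everywhere. -/
theorem exists_eLpNorm_sub_trunc_le {p : ℝ≥0∞} (hg : MemLp g p μ) {ε : ℝ} (hε : 0 < ε) :
    ∃ M : ℝ, ∀ B, M ≤ B → eLpNorm (fun x => g x - trunc B (g x)) p μ ≤ ENNReal.ofReal ε := by
  obtain ⟨g', hg', hgg'⟩ := hg.1
  obtain ⟨M, hM⟩ := ((memLp_congr_ae hgg').1 hg).eLpNorm_indicator_norm_ge_le hg' hε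
  refine ⟨M, fun B hB => (eLpNorm_mono_ae ?_).trans hM⟩
  filter_upwards [hgg'] with x hx
  rcases le_or_gt |g x| B with h | h
  · simp [trunc_of_le h]
  · rw [trunc_of_lt h, sub_zero, Set.indicator_of_mem]
    · rw [← hx]
    · simp only [Set.mem_ofPred_eq, ← hx, coe_nnnorm, Real.norm_eq_abs]
      linarith

end

/-! ### Estimates away from the origin -/

/-- Away from the origin the oscillation bound `2 / |x|` alone gives a constant independent of `T`.
-/
theorem norm_dirichlet_le_of_le_abs {T δ x : ℝ} (hT : 0 ≤ T) (hδ : 0 < δ) (hx : δ ≤ |x|) :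
    ‖dirichlet T x‖ ≤ 2 * (1 + 1 / δ) * (1 + |x|)⁻¹ := by
  have h := abs_mul_norm_dirichlet_le hT x
  have h1 : 1 ≤ |x| / δ := (one_le_div hδ).2 hx
  rw [← div_eq_mul_inv, le_div_iff₀ (by positivity)]
  have h2 : 1 + |x| ≤ (1 + 1 / δ) * |x| := by
    have : (1 + 1 / δ) * |x| = |x| + |x| / δ := by ring
    linarith
  calc ‖dirichlet T x‖ * (1 + |x|) ≤ ‖dirichlet T x‖ * ((1 + 1 / δ) * |x|) := by gcongr
    _ = (1 + 1 / δ) * (|x| * ‖dirichlet T x‖) := by ring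
    _ ≤ (1 + 1 / δ) * 2 := by gcongr
    _ = _ := by ring

/-- Off the `δ`-ball, two of the factors of the cyclic product stay bounded. -/
theorem exists_norm_prod_dirichlet_steps_le {m : ℕ} {δ : ℝ} (hδ : 0 < δ) :
    ∃ C : ℝ, 0 ≤ C ∧ ∀ T : ℝ, 0 ≤ T → ∀ y : Fin (m + 1) → ℝ, δ ≤ ‖y‖ →
      ∃ (i : Fin (m + 2)) (j : Fin (m + 1)), ‖∏ k, dirichlet T (steps 0 y 0 k)‖ ≤
        C * ((1 + |steps 0 y 0 (i.succAbove j)|)⁻¹ *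
          ∏ l : Fin m, ‖dirichlet T (steps 0 y 0 (i.succAbove (j.succAbove l)))‖) := by
  set δ' := δ / (((m + 1 : ℕ) : ℝ) + 1) ^ 2 with hδ'
  have hδ'0 : 0 < δ' := by positivity
  set c := 2 * (1 + 1 / δ') with hc
  have hc0 : 0 ≤ c := by positivity
  refine ⟨c * c, by positivity, fun T hT y hy => ?_⟩
  obtain ⟨i, j, hi, hj⟩ := exists_two_long_steps hδ y hy
  refine ⟨i, j, ?_⟩
  rw [norm_prod, Fin.prod_univ_succAbove _ i, Fin.prod_univ_succAbove _ j, ← mul_assoc]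
  -- The factor at `i` is bounded by a constant, so increment `i` can be dropped; the other long one
  -- keeps its decay, needed for integrability in its coordinate.
  have h1 : ‖dirichlet T (steps 0 y 0 i)‖ ≤ c := by
    refine (norm_dirichlet_le_of_le_abs hT hδ'0 hi).trans (mul_le_of_le_one_right hc0 ?_)
    exact inv_le_one_of_one_le₀ (by linarith [abs_nonneg (steps 0 y 0 i)])
  have h2 := norm_dirichlet_le_of_le_abs hT hδ'0 hj
  rw [← mul_assoc]
  refine mul_le_mul_of_nonneg_right ?_ (Finset.prod_nonneg fun l _ => norm_nonneg _)
  rw [mul_assoc]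
  exact mul_le_mul h1 h2 (norm_nonneg _) hc0

/-- By scaling: height `T` to the power `q`, width `1 / T`, and a tail that is integrable because `q
> 1`. -/
theorem integral_norm_dirichlet_rpow_le {q : ℝ} (hq : 1 < q) :
    ∃ C : ℝ, 0 ≤ C ∧ ∀ T : ℝ, 0 < T →
      ∫⁻ x, ENNReal.ofReal (‖dirichlet T x‖ ^ q) ≤ ENNReal.ofReal (C * T ^ (q - 1)) := by
  set I := ∫ x : ℝ, ((1 + |x|)⁻¹) ^ q with hI
  have hI0 : 0 ≤ I := integral_nonneg fun x => by positivity
  refine ⟨3 ^ q * I, by positivity, fun T hT => ?_⟩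
  have hint : Integrable fun x : ℝ => ((1 + |T * x|)⁻¹) ^ q :=
    (integrable_one_add_abs_inv_rpow hq).comp_mul_left' hT.ne'
  calc ∫⁻ x, ENNReal.ofReal (‖dirichlet T x‖ ^ q)
      ≤ ∫⁻ x, ENNReal.ofReal ((3 * T) ^ q * ((1 + |T * x|)⁻¹) ^ q) := by
        refine lintegral_mono fun x => ENNReal.ofReal_le_ofReal ?_
        rw [← Real.mul_rpow (by positivity) (by positivity)]
        exact Real.rpow_le_rpow (norm_nonneg _) (norm_dirichlet_le_mul_inv hT.le x) (by linarith)
    _ = ENNReal.ofReal (∫ x, (3 * T) ^ q * ((1 + |T * x|)⁻¹) ^ q) :=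
        (ofReal_integral_eq_lintegral_ofReal (hint.const_mul _)
          (ae_of_all _ fun x => by positivity)).symm
    _ = _ := by
        rw [integral_const_mul, Measure.integral_comp_mul_left
          (fun x : ℝ => ((1 + |x|)⁻¹) ^ q) T, smul_eq_mul, abs_of_pos (inv_pos.2 hT),
          Real.mul_rpow (by norm_num) hT.le, Real.rpow_sub_one hT.ne']
        change ENNReal.ofReal (3 ^ q * T ^ q * (T⁻¹ * I)) = _
        congr 1
        field_simp

/-- The cyclic product of Dirichlet kernels, off the `δ`-ball, is bounded in `L^{m / (m - 1)}`. -/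
theorem exists_lintegral_prod_dirichlet_steps_rpow_le {m : ℕ} (hm : 2 ≤ m) {δ : ℝ} (hδ : 0 < δ) :
    ∃ C : ℝ, 0 ≤ C ∧ ∀ T : ℝ, 0 < T →
      ∫⁻ y in {y : Fin (m + 1) → ℝ | δ ≤ ‖y‖},
        ENNReal.ofReal ((‖∏ k, dirichlet T (steps 0 y 0 k)‖ / T) ^ ((m : ℝ) / (m - 1)))
        ≤ ENNReal.ofReal C := by
  set q : ℝ := (m : ℝ) / (m - 1) with hq
  have hm1 : (0 : ℝ) < m - 1 := by
    have : (2 : ℝ) ≤ m := by exact_mod_cast hm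
    linarith
  have hq1 : 1 < q := by rw [hq, one_lt_div hm1]; linarith
  have hq0 : 0 < q := by linarith
  obtain ⟨C₁, hC₁, hpt⟩ := exists_norm_prod_dirichlet_steps_le (m := m) hδ
  obtain ⟨C₂, hC₂, hD⟩ := integral_norm_dirichlet_rpow_le hq1
  set I := ∫ x : ℝ, ((1 + |x|)⁻¹) ^ q with hI
  have hI0 : 0 ≤ I := integral_nonneg fun x => by positivity
  have hIl : ∫⁻ x : ℝ, ENNReal.ofReal (((1 + |x|)⁻¹) ^ q) = ENNReal.ofReal I :=
    (ofReal_integral_eq_lintegral_ofReal (integrable_one_add_abs_inv_rpow hq1)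
      (ae_of_all _ fun x => by positivity)).symm
  refine ⟨((m + 2 : ℕ) : ℝ) * ((m + 1 : ℕ) * (C₁ ^ q * (I * C₂ ^ m))), by positivity,
    fun T hT => ?_⟩
  -- Among the `m + 1` increments left, the `j`-th carries the decaying weight and the other `m`
  -- carry Dirichlet kernels.
  let F : Fin (m + 1) → Fin (m + 1) → ℝ → ℝ≥0∞ := fun j k x =>
    if k = j then ENNReal.ofReal (((1 + |x|)⁻¹) ^ q) else ENNReal.ofReal (‖dirichlet T x‖ ^ q)
  have hFm : ∀ j k, Measurable (F j k) := by
    intro j k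
    by_cases h : k = j
    · simp only [F, h, if_true]
      exact (continuous_one_add_abs_inv.rpow_const fun _ => Or.inr hq0.le).measurable.ennreal_ofReal
    · simp only [F, h, if_false]
      exact ((continuous_dirichlet T).norm.rpow_const fun _ =>
        Or.inr hq0.le).measurable.ennreal_ofReal
  have hFp : ∀ (j : Fin (m + 1)) (z : Fin (m + 1) → ℝ), ∏ k, F j k (z k)
      = ENNReal.ofReal (((1 + |z j|)⁻¹ * ∏ l, ‖dirichlet T (z (j.succAbove l))‖) ^ q) := by
    intro j z
    rw [Fin.prod_univ_succAbove _ j, Real.mul_rpow (by positivity)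
      (Finset.prod_nonneg fun l _ => norm_nonneg _), ENNReal.ofReal_mul (by positivity),
      ← Real.finsetProd_rpow _ _ (fun l _ => norm_nonneg _),
      ENNReal.ofReal_prod_of_nonneg fun l _ => by positivity]
    simp [F, Fin.succAbove_ne]
  have hFI : ∀ j, ∏ k, ∫⁻ x, F j k x ≤ ENNReal.ofReal (I * (C₂ * T ^ (q - 1)) ^ m) := by
    intro j
    rw [Fin.prod_univ_succAbove _ j, ENNReal.ofReal_mul hI0, ENNReal.ofReal_pow (by positivity)]
    simp only [F, Fin.succAbove_ne, if_true, if_false, hIl]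
    refine mul_le_mul_right ?_ _
    rw [Finset.prod_const, Finset.card_univ, Fintype.card_fin]
    exact pow_le_pow_left' (hD T hT) m
  -- The positions `i, j` of the long increments depend on `y`, so all pairs are summed.
  have hpt' : ∀ y ∈ {y : Fin (m + 1) → ℝ | δ ≤ ‖y‖},
      ENNReal.ofReal ((‖∏ k, dirichlet T (steps 0 y 0 k)‖ / T) ^ q)
      ≤ ∑ i : Fin (m + 2), ∑ j, ENNReal.ofReal ((C₁ / T) ^ q) *
        ∏ k, F j k (steps 0 y 0 (i.succAbove k)) := by
    intro y hy
    obtain ⟨i, j, hij⟩ := hpt T hT.le y hy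
    have h1 : ENNReal.ofReal ((‖∏ k, dirichlet T (steps 0 y 0 k)‖ / T) ^ q)
        ≤ ENNReal.ofReal ((C₁ / T) ^ q) * ∏ k, F j k (steps 0 y 0 (i.succAbove k)) := by
      rw [hFp j fun k => steps 0 y 0 (i.succAbove k), ← ENNReal.ofReal_mul (by positivity),
        ← Real.mul_rpow (by positivity)
          (mul_nonneg (by positivity) (Finset.prod_nonneg fun l _ => norm_nonneg _))]
      refine ENNReal.ofReal_le_ofReal (Real.rpow_le_rpow (by positivity) ?_ hq0.le)
      rw [div_mul_eq_mul_div]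
      exact div_le_div_of_nonneg_right hij hT.le
    refine h1.trans ?_
    refine le_trans ?_ (Finset.single_le_sum (f := fun i : Fin (m + 2) =>
      ∑ j, ENNReal.ofReal ((C₁ / T) ^ q) * ∏ k, F j k (steps 0 y 0 (i.succAbove k)))
      (fun _ _ => zero_le) (Finset.mem_univ i))
    exact Finset.single_le_sum (f := fun j =>
      ENNReal.ofReal ((C₁ / T) ^ q) * ∏ k, F j k (steps 0 y 0 (i.succAbove k)))
      (fun _ _ => zero_le) (Finset.mem_univ j)
  have hmeas' : ∀ (i : Fin (m + 2)) (j : Fin (m + 1)), Measurable fun y : Fin (m + 1) → ℝ =>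
      ∏ k, F j k (steps 0 y 0 (i.succAbove k)) := fun i j =>
    Finset.measurable_fun_prod _ fun k _ =>
      (hFm j k).comp (continuous_steps_path 0 0 _).measurable
  have hmeas : ∀ (i : Fin (m + 2)) (j : Fin (m + 1)), Measurable fun y : Fin (m + 1) → ℝ =>
      ENNReal.ofReal ((C₁ / T) ^ q) * ∏ k, F j k (steps 0 y 0 (i.succAbove k)) := fun i j =>
    (hmeas' i j).const_mul _
  calc ∫⁻ y in {y : Fin (m + 1) → ℝ | δ ≤ ‖y‖},
        ENNReal.ofReal ((‖∏ k, dirichlet T (steps 0 y 0 k)‖ / T) ^ q)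
      ≤ ∫⁻ y : Fin (m + 1) → ℝ, ∑ i : Fin (m + 2), ∑ j, ENNReal.ofReal ((C₁ / T) ^ q) *
        ∏ k, F j k (steps 0 y 0 (i.succAbove k)) :=
        (setLIntegral_mono' (measurableSet_le measurable_const measurable_norm) hpt').trans
          (setLIntegral_le_lintegral _ _)
    _ = ∑ i : Fin (m + 2), ∑ j, ENNReal.ofReal ((C₁ / T) ^ q) *
        ∏ k, ∫⁻ x, F j k x := by
        rw [lintegral_finsetSum _ fun i _ => Finset.measurable_fun_sum _ fun j _ => hmeas i j]
        refine Finset.sum_congr rfl fun i _ => ?_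
        rw [lintegral_finsetSum _ fun j _ => hmeas i j]
        refine Finset.sum_congr rfl fun j _ => ?_
        rw [lintegral_const_mul _ (hmeas' i j), lintegral_prod_steps_succAbove (hFm j)]
    _ ≤ ∑ _i : Fin (m + 2), ∑ _j : Fin (m + 1), ENNReal.ofReal ((C₁ / T) ^ q) *
        ENNReal.ofReal (I * (C₂ * T ^ (q - 1)) ^ m) := by
        gcongr with i _ j _
        exact hFI j
    _ = _ := by
        -- The exponent is chosen for `m (q - 1) = q`: the growth of `m` kernels in `L^q` cancels
        -- the normalisation `T⁻¹` exactly.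
        have hTq : (T ^ (q - 1)) ^ m = T ^ q := by
          rw [← Real.rpow_natCast, ← Real.rpow_mul hT.le]
          congr 1
          rw [hq]
          field_simp
          ring
        have hT1 : T ^ q ≠ 0 := (Real.rpow_pos_of_pos hT q).ne'
        rw [← ENNReal.ofReal_mul (by positivity), mul_pow, hTq, Real.div_rpow hC₁ hT.le,
          show C₁ ^ q / T ^ q * (I * (C₂ ^ m * T ^ q)) = C₁ ^ q * (I * C₂ ^ m) by field_simp,
          Finset.sum_const, Finset.sum_const, Finset.card_univ, Finset.card_univ,
          Fintype.card_fin, Fintype.card_fin, nsmul_eq_mul, nsmul_eq_mul,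
          ← ENNReal.ofReal_natCast (m + 1), ← ENNReal.ofReal_natCast (m + 2),
          ← ENNReal.ofReal_mul (by positivity), ← ENNReal.ofReal_mul (by positivity)]

/-- The normalised cyclic kernel acts on functions supported off the `δ`-ball as a bounded
functional on `L^{max m 1}`, uniformly in `T ≥ 1`. -/
theorem exists_lintegral_mul_prod_dirichlet_steps_le (m : ℕ) {δ : ℝ} (hδ : 0 < δ) :
    ∃ C : ℝ, 0 ≤ C ∧ ∀ T : ℝ, 1 ≤ T → ∀ g : (Fin (m + 1) → ℝ) → ℝ,
      AEStronglyMeasurable g volume → (∀ y, ‖y‖ < δ → g y = 0) →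
      ∫⁻ y, ‖g y‖ₑ * ENNReal.ofReal (‖∏ k, dirichlet T (steps 0 y 0 k)‖ / T)
        ≤ eLpNorm g ((max m 1 : ℕ) : ℝ≥0∞) volume * ENNReal.ofReal C := by
  -- For `m ≤ 1` the kernel is bounded off the ball: the `m` remaining factors, each at most `T`,
  -- are offset by `1 / T`, since `T ≥ 1`. For `m ≥ 2` Hölder's inequality is used.
  rcases le_or_gt m 1 with hm | hm
  · obtain ⟨C, hC, hpt⟩ := exists_norm_prod_dirichlet_steps_le (m := m) hδ
    refine ⟨C, hC, fun T hT g hg hg0 => ?_⟩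
    have hT0 : 0 < T := by linarith
    rw [max_eq_right hm, Nat.cast_one, eLpNorm_one_eq_lintegral_enorm,
      ← lintegral_mul_const' _ _ ENNReal.ofReal_ne_top]
    refine lintegral_mono fun y => ?_
    rcases lt_or_ge ‖y‖ δ with hy | hy
    · simp [hg0 y hy]
    · refine mul_le_mul_right (ENNReal.ofReal_le_ofReal ?_) _
      obtain ⟨i, j, hij⟩ := hpt T hT0.le y hy
      rw [div_le_iff₀ hT0]
      refine hij.trans (mul_le_mul_of_nonneg_left ?_ hC)
      calc (1 + |steps 0 y 0 (i.succAbove j)|)⁻¹ *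
            ∏ l : Fin m, ‖dirichlet T (steps 0 y 0 (i.succAbove (j.succAbove l)))‖
          ≤ 1 * ∏ _l : Fin m, T := by
            refine mul_le_mul ?_ ?_ (Finset.prod_nonneg fun l _ => norm_nonneg _) zero_le_one
            · exact inv_le_one_of_one_le₀ (by linarith [abs_nonneg (steps 0 y 0 (i.succAbove j))])
            · exact Finset.prod_le_prod (fun l _ => norm_nonneg _) fun l _ =>
                norm_dirichlet_le hT0.le _
        _ = T ^ m := by simp
        _ ≤ T ^ 1 := pow_le_pow_right₀ hT hm
        _ = T := pow_one T
  · obtain ⟨C, hC, hLq⟩ := exists_lintegral_prod_dirichlet_steps_rpow_le (m := m) hm hδ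
    set q : ℝ := (m : ℝ) / (m - 1) with hq
    have hm1 : (1 : ℝ) < m := by exact_mod_cast hm
    have hpq : (m : ℝ).HolderConjugate q := Real.HolderConjugate.conjExponent hm1
    refine ⟨C ^ (1 / q), by positivity, fun T hT g hg hg0 => ?_⟩
    have hT0 : 0 < T := by linarith
    set K : (Fin (m + 1) → ℝ) → ℝ≥0∞ := {y | δ ≤ ‖y‖}.indicator fun y =>
      ENNReal.ofReal (‖∏ k, dirichlet T (steps 0 y 0 k)‖ / T) with hK
    have hset : MeasurableSet {y : Fin (m + 1) → ℝ | δ ≤ ‖y‖} :=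
      measurableSet_le measurable_const measurable_norm
    have hKm : Measurable K := Measurable.indicator
      ((continuous_prod_dirichlet_steps_path T 0 0).norm.div_const T).measurable.ennreal_ofReal hset
    have hKq : ∫⁻ y, K y ^ q ≤ ENNReal.ofReal C := by
      refine le_trans (le_of_eq ?_) (hLq T hT0)
      rw [← lintegral_indicator hset]
      refine lintegral_congr fun y => ?_
      by_cases hy : y ∈ {y : Fin (m + 1) → ℝ | δ ≤ ‖y‖}
      · rw [hK, Set.indicator_of_mem hy, Set.indicator_of_mem hy,
          ENNReal.ofReal_rpow_of_nonneg (by positivity) hpq.symm.nonneg]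
      · rw [hK, Set.indicator_of_notMem hy, Set.indicator_of_notMem hy,
          ENNReal.zero_rpow_of_pos hpq.symm.pos]
    have hmul : ∀ y, ‖g y‖ₑ * ENNReal.ofReal (‖∏ k, dirichlet T (steps 0 y 0 k)‖ / T)
        = ((fun y => ‖g y‖ₑ) * K) y := by
      intro y
      rw [Pi.mul_apply]
      rcases lt_or_ge ‖y‖ δ with hy | hy
      · simp [hg0 y hy]
      · rw [hK, Set.indicator_of_mem (show y ∈ {y : Fin (m + 1) → ℝ | δ ≤ ‖y‖} from hy)]
    simp only [hmul]
    refine (ENNReal.lintegral_mul_le_Lp_mul_Lq volume hpq hg.enorm hKm.aemeasurable).trans ?_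
    rw [max_eq_left hm.le, eLpNorm_eq_lintegral_rpow_enorm_toReal
      (by exact_mod_cast (by omega : m ≠ 0)) (by simp),
      ENNReal.toReal_natCast]
    refine mul_le_mul_right ?_ _
    rw [← ENNReal.ofReal_rpow_of_nonneg hC (by have := hpq.symm.pos; positivity)]
    exact ENNReal.rpow_le_rpow hKq (by have := hpq.symm.pos; positivity)

/-! ### The cyclic kernel is an approximate identity -/

theorem norm_prod_dirichlet_steps_le {n : ℕ} {T : ℝ} (hT : 0 ≤ T) (a b : ℝ) (y : Fin n → ℝ) :
    ‖∏ k, dirichlet T (steps a y b k)‖ ≤ T ^ (n + 1) := by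
  rw [norm_prod]
  refine (Finset.prod_le_prod (fun k _ => norm_nonneg _) fun k _ =>
    norm_dirichlet_le hT _).trans (le_of_eq ?_)
  simp

theorem integrable_mul_prod_dirichlet_steps {n : ℕ} {T : ℝ} (hT : 0 ≤ T)
    {g : (Fin n → ℝ) → ℝ} (hg : Integrable g) :
    Integrable fun y => (g y : ℂ) * ∏ k, dirichlet T (steps 0 y 0 k) :=
  hg.ofReal.mul_bdd (continuous_prod_dirichlet_steps_path T 0 0).aestronglyMeasurable
    (ae_of_all _ fun y => norm_prod_dirichlet_steps_le hT 0 0 y)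

/-- After `y → T⁻¹ y` the kernel no longer depends on `T` and is integrable, while `g (T⁻¹ y)` tends
to `g 0` boundedly. -/
theorem tendsto_integral_mul_prod_dirichlet_of_bounded {n : ℕ} {g : (Fin n → ℝ) → ℝ}
    (hg : Integrable g) {B : ℝ} (hB : ∀ y, |g y| ≤ B) (h0 : ContinuousAt g 0) :
    Tendsto (fun T : ℝ => (1 / (T : ℂ)) * ∫ y, (g y : ℂ) * ∏ k, dirichlet T (steps 0 y 0 k))
      atTop (𝓝 ((2 * Real.pi) ^ n * g 0)) := by
  have hscale : ∀ T : ℝ, 0 < T →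
      (1 / (T : ℂ)) * ∫ y, (g y : ℂ) * ∏ k, dirichlet T (steps 0 y 0 k)
      = ∫ y : Fin n → ℝ, (g (T⁻¹ • y) : ℂ) * ∏ k, dirichlet 1 (steps 0 y 0 k) := by
    intro T hT
    have h1 := Measure.integral_comp_smul (volume : Measure (Fin n → ℝ))
      (fun y : Fin n → ℝ => (g (T⁻¹ • y) : ℂ) * ∏ k, dirichlet 1 (steps 0 y 0 k)) T
    simp only [smul_smul, inv_mul_cancel₀ hT.ne', one_smul, Module.finrank_fin_fun] at h1
    have h2 : ∀ y : Fin n → ℝ, (g y : ℂ) * ∏ k, dirichlet T (steps 0 y 0 k)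
        = (T : ℂ) ^ (n + 1) * ((g y : ℂ) * ∏ k, dirichlet 1 (steps 0 (T • y) 0 k)) := by
      intro y
      rw [prod_dirichlet_steps_eq hT]
      ring
    simp only [h2]
    have hTc : (T : ℂ) ≠ 0 := by exact_mod_cast hT.ne'
    rw [integral_const_mul, h1, abs_of_pos (by positivity), Complex.real_smul]
    push_cast
    rw [← mul_assoc, ← mul_assoc, pow_succ]
    field_simp
  have hlim : ((2 * Real.pi) ^ n * g 0 : ℂ)
      = ∫ y : Fin n → ℝ, (g 0 : ℂ) * ∏ k, dirichlet 1 (steps 0 y 0 k) := by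
    rw [integral_const_mul, integral_prod_dirichlet_steps, sub_self, dirichlet_zero zero_le_one]
    push_cast
    ring
  rw [hlim]
  refine Tendsto.congr' (f₁ := fun T : ℝ => ∫ y : Fin n → ℝ,
    (g (T⁻¹ • y) : ℂ) * ∏ k, dirichlet 1 (steps 0 y 0 k)) ?_ ?_
  · filter_upwards [eventually_gt_atTop 0] with T hT
    exact (hscale T hT).symm
  · refine tendsto_integral_filter_of_dominated_convergence
      (fun y : Fin n → ℝ => B * ‖∏ k, dirichlet 1 (steps 0 y 0 k)‖) ?_ ?_
      ((integrable_prod_dirichlet_steps 0 0).norm.const_mul B) ?_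
    · filter_upwards [eventually_gt_atTop 0] with T hT
      exact ((hg.comp_smul (inv_ne_zero hT.ne')).ofReal).1.mul
        (continuous_prod_dirichlet_steps_path 1 0 0).aestronglyMeasurable
    · refine Eventually.of_forall fun T => ae_of_all _ fun y => ?_
      rw [norm_mul, Complex.norm_real]
      exact mul_le_mul_of_nonneg_right (hB _) (norm_nonneg _)
    · refine ae_of_all _ fun y => Tendsto.mul_const _ ?_
      refine (Complex.continuous_ofReal.tendsto _).comp ?_
      refine h0.tendsto.comp ?_
      have := (tendsto_inv_atTop_zero (𝕜 := ℝ)).smul_const y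
      rwa [zero_smul] at this

/-- Continuity bounds `g` near `0`, so truncation at a high level changes it only off a ball. There
the remainder, small in norm, is controlled uniformly in `T`; the truncated part falls under the
bounded case. -/
theorem tendsto_integral_mul_prod_dirichlet {m : ℕ} {g : (Fin (m + 1) → ℝ) → ℝ}
    (hg : Integrable g) (hgm : MemLp g (m : ℝ≥0∞) volume) (h0 : ContinuousAt g 0) :
    Tendsto (fun T : ℝ => (1 / (T : ℂ)) * ∫ y, (g y : ℂ) * ∏ k, dirichlet T (steps 0 y 0 k))
      atTop (𝓝 ((2 * Real.pi) ^ (m + 1) * g 0)) := by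
  -- For `m = 0` the `L^m` hypothesis carries only measurability; integrability of `g` replaces it.
  have hge : MemLp g ((max m 1 : ℕ) : ℝ≥0∞) volume := by
    rcases le_or_gt m 1 with hm | hm
    · rw [max_eq_right hm, Nat.cast_one]
      exact memLp_one_iff_integrable.2 hg
    · rwa [max_eq_left hm.le]
  set B₀ := |g 0| + 1 with hB₀
  have hnear : ∀ᶠ y in 𝓝 (0 : Fin (m + 1) → ℝ), |g y| < B₀ :=
    h0.abs.eventually_lt continuousAt_const (by simp [hB₀])
  obtain ⟨δ, hδ, hball⟩ := Metric.eventually_nhds_iff.1 hnear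
  simp only [dist_zero_right] at hball
  obtain ⟨C, hC, hbd⟩ := exists_lintegral_mul_prod_dirichlet_steps_le m hδ
  rw [Metric.tendsto_atTop']
  intro ε hε
  -- `C + 1` rather than `C`, which may vanish.
  obtain ⟨M, hM⟩ := exists_eLpNorm_sub_trunc_le hge (ε := ε / (2 * (C + 1))) (by positivity)
  set B := max M B₀ with hB
  have hB0 : 0 ≤ B := le_trans (by positivity) (le_max_right M B₀)
  set gb : (Fin (m + 1) → ℝ) → ℝ := fun y => trunc B (g y) with hgb
  have hgbi : Integrable gb :=
    memLp_one_iff_integrable.1 (memLp_trunc (memLp_one_iff_integrable.2 hg) B)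
  have hgbnear : ∀ y, ‖y‖ < δ → gb y = g y := fun y hy =>
    trunc_of_le ((hball hy).le.trans (le_max_right _ _))
  have hgb0 : gb 0 = g 0 := hgbnear 0 (by simpa using hδ)
  have hev : gb =ᶠ[𝓝 0] g :=
    Metric.eventually_nhds_iff.2 ⟨δ, hδ, fun y hy => hgbnear y (by simpa using hy)⟩
  have hmain := tendsto_integral_mul_prod_dirichlet_of_bounded hgbi
    (fun y => abs_trunc_le hB0 (g y)) (h0.congr hev.symm)
  rw [hgb0] at hmain
  obtain ⟨N, hN⟩ := Metric.tendsto_atTop'.1 hmain (ε / 2) (by positivity)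
  refine ⟨max N 1, fun T hT => ?_⟩
  have hT1 : 1 ≤ T := (le_max_right _ _).trans hT.le
  have hT0 : 0 < T := by linarith
  have hlt := hN T ((le_max_left _ _).trans_lt hT)
  refine (dist_triangle _ ((1 / (T : ℂ)) * ∫ y, (gb y : ℂ) * ∏ k, dirichlet T (steps 0 y 0 k))
    _).trans_lt ?_
  have hfar : dist ((1 / (T : ℂ)) * ∫ y, (g y : ℂ) * ∏ k, dirichlet T (steps 0 y 0 k))
      ((1 / (T : ℂ)) * ∫ y, (gb y : ℂ) * ∏ k, dirichlet T (steps 0 y 0 k)) ≤ ε / 2 := by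
    have h1 := hbd T hT1 (fun y => g y - gb y) (hg.sub hgbi).1
      (fun y hy => by rw [hgbnear y hy, sub_self])
    rw [dist_eq_norm, ← mul_sub, ← integral_sub (integrable_mul_prod_dirichlet_steps hT0.le hg)
      (integrable_mul_prod_dirichlet_steps hT0.le hgbi), ← integral_const_mul]
    have h2 := enorm_integral_le_lintegral_enorm (μ := volume) fun y : Fin (m + 1) → ℝ =>
      (1 / (T : ℂ)) * ((g y : ℂ) * ∏ k, dirichlet T (steps 0 y 0 k)
        - (gb y : ℂ) * ∏ k, dirichlet T (steps 0 y 0 k))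
    have h3 : ∀ y : Fin (m + 1) → ℝ,
        ‖(1 / (T : ℂ)) * ((g y : ℂ) * ∏ k, dirichlet T (steps 0 y 0 k)
        - (gb y : ℂ) * ∏ k, dirichlet T (steps 0 y 0 k))‖ₑ
        = ‖g y - gb y‖ₑ * ENNReal.ofReal (‖∏ k, dirichlet T (steps 0 y 0 k)‖ / T) := by
      intro y
      rw [← sub_mul, ← Complex.ofReal_sub, ← ofReal_norm, ← ofReal_norm,
        ← ENNReal.ofReal_mul (norm_nonneg _), norm_mul, norm_mul, Complex.norm_real, norm_div,
        Complex.norm_real, Real.norm_of_nonneg hT0.le, norm_one]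
      congr 1
      ring
    simp only [h3] at h2
    have h4 : eLpNorm (fun y => g y - gb y) ((max m 1 : ℕ) : ℝ≥0∞) volume * ENNReal.ofReal C
        ≤ ENNReal.ofReal (ε / 2) := by
      refine (mul_le_mul_left (hM B (le_max_left _ _)) _).trans ?_
      rw [← ENNReal.ofReal_mul (by positivity)]
      refine ENNReal.ofReal_le_ofReal ?_
      rw [div_mul_eq_mul_div, div_le_div_iff₀ (by positivity) (by positivity)]
      nlinarith
    have h5 := h2.trans (h1.trans h4)
    rw [← ofReal_norm] at h5
    exact (ENNReal.ofReal_le_ofReal_iff (by positivity)).1 h5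
  linarith

theorem trace_eq_tsum_inner {H : Type*} [NormedAddCommGroup H] [InnerProductSpace ℂ H]
    [CompleteSpace H] {A : H →L[ℂ] H} {x y : ℕ → H}
    (hxy : Summable (fun k => ‖x k‖ * ‖y k‖))
    (hA : ∀ v : H, HasSum (fun k => ⟪x k, v⟫_ℂ • y k) (A v)) :
    trace A = ∑' k, ⟪x k, y k⟫_ℂ :=
  (hasSum_inner_basis hxy hA (exists_hilbertBasis ℂ H).choose_spec.choose).tsum_eq

/-! ### Exponentials in `L²[0,T]` -/

theorem memLp_of_continuous {T : ℝ} {w : ℝ → ℂ} (hw : Continuous w) :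
    MemLp w 2 (volume.restrict (Set.Icc (0 : ℝ) T)) := by
  obtain ⟨C, hC⟩ := isCompact_Icc.exists_bound_of_continuousOn (s := Set.Icc (0 : ℝ) T)
    hw.continuousOn
  exact MemLp.of_bound hw.aestronglyMeasurable C
    ((ae_restrict_iff' measurableSet_Icc).2 (ae_of_all _ hC))

/-- The class in `L²[0,T]` of a continuous function. -/
def ofContinuous (T : ℝ) (w : C(ℝ, ℂ)) : L2 T := (memLp_of_continuous w.continuous).toLp _

theorem ofContinuous_ae (T : ℝ) (w : C(ℝ, ℂ)) :
    ofContinuous T w =ᵐ[volume.restrict (Set.Icc (0 : ℝ) T)] w := MemLp.coeFn_toLp _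

theorem inner_ofContinuous {T : ℝ} (u : L2 T) (w : C(ℝ, ℂ)) :
    ⟪u, ofContinuous T w⟫_ℂ = ∫ t in Set.Icc (0 : ℝ) T, starRingEnd ℂ (u t) * w t := by
  rw [L2.inner_def]
  refine integral_congr_ae ?_
  filter_upwards [ofContinuous_ae T w] with t ht
  rw [RCLike.inner_apply, ht, mul_comm]

theorem norm_ofContinuous_le {T : ℝ} (hT : 0 ≤ T) (w : C(ℝ, ℂ)) {C : ℝ} (hC0 : 0 ≤ C)
    (hC : ∀ t ∈ Set.Icc (0 : ℝ) T, ‖w t‖ ≤ C) : ‖ofContinuous T w‖ ≤ √T * C := by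
  have h := Lp.norm_le_of_ae_bound (p := 2) (f := ofContinuous T w) hC0 (by
    filter_upwards [ofContinuous_ae T w, ae_restrict_mem measurableSet_Icc] with t ht hmem
    rw [ht]
    exact hC t hmem)
  refine h.trans (le_of_eq ?_)
  have hm : (measureUnivNNReal (volume.restrict (Set.Icc (0 : ℝ) T)) : ℝ) = T := by
    simp [measureUnivNNReal, ENNReal.coe_toNNReal_eq_toReal, hT]
  rw [Real.sqrt_eq_rpow, hm]
  simp

theorem L2.integrable_conj {T : ℝ} (u : L2 T) :
    Integrable (fun t => starRingEnd ℂ (u t)) (volume.restrict (Set.Icc (0 : ℝ) T)) :=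
  (L2.integrable u).congr' (RCLike.continuous_conj.comp_aestronglyMeasurable (L2.integrable u).1)
    (ae_of_all _ fun _ => (RCLike.norm_conj _).symm)

/-- The exponential function with frequency `x`. -/
def expMap (x : ℝ) : C(ℝ, ℂ) := ⟨fun t => Complex.exp (Complex.I * x * t), by fun_prop⟩

/-- The exponential with frequency `x` as a vector of `L²[0,T]`. -/
def expVec (T x : ℝ) : L2 T := ofContinuous T (expMap x)

theorem inner_expVec {T : ℝ} (u : L2 T) (x : ℝ) :
    ⟪u, expVec T x⟫_ℂ
      = ∫ t in Set.Icc (0 : ℝ) T, starRingEnd ℂ (u t) * Complex.exp (Complex.I * x * t) :=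
  inner_ofContinuous u _

theorem conj_exp_I_mul (x t : ℝ) : starRingEnd ℂ (Complex.exp (Complex.I * x * t))
    = Complex.exp (-(Complex.I * x * t)) := by
  rw [← Complex.exp_conj]
  simp

theorem expVec_inner {T : ℝ} (u : L2 T) (x : ℝ) :
    ⟪expVec T x, u⟫_ℂ
      = ∫ t in Set.Icc (0 : ℝ) T, Complex.exp (-(Complex.I * x * t)) * u t := by
  rw [← inner_conj_symm, inner_expVec, ← integral_conj]
  refine integral_congr_ae (ae_of_all _ fun t => ?_)
  simp only [map_mul, Complex.conj_conj, conj_exp_I_mul]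
  ring

theorem inner_expVec_expVec (T a b : ℝ) : ⟪expVec T a, expVec T b⟫_ℂ = dirichlet T (b - a) := by
  rw [inner_expVec, dirichlet]
  refine integral_congr_ae ?_
  filter_upwards [ofContinuous_ae T (expMap a)] with t ht
  rw [expVec, ht]
  change starRingEnd ℂ (Complex.exp (Complex.I * a * t)) * _ = _
  rw [conj_exp_I_mul, ← Complex.exp_add]
  congr 1
  push_cast
  ring

theorem norm_expVec_le {T : ℝ} (hT : 0 ≤ T) (x : ℝ) : ‖expVec T x‖ ≤ √T := by
  have h := norm_ofContinuous_le hT (expMap x) zero_le_one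
    (fun t _ => (norm_exp_I_mul_mul x t).le)
  rwa [mul_one] at h

/-- The squared distance of two exponentials expands into values of the continuous Dirichlet kernel.
-/
theorem continuous_expVec (T : ℝ) : Continuous (expVec T) := by
  rw [continuous_iff_continuousAt]
  intro a
  rw [ContinuousAt, tendsto_iff_norm_sub_tendsto_zero]
  have h1 : ∀ x, ‖expVec T x - expVec T a‖ = √(RCLike.re (dirichlet T (x - x))
      - 2 * RCLike.re (dirichlet T (a - x)) + RCLike.re (dirichlet T (a - a))) := by
    intro x
    rw [← inner_expVec_expVec, ← inner_expVec_expVec, ← inner_expVec_expVec,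
      inner_self_eq_norm_sq, inner_self_eq_norm_sq, ← norm_sub_sq, Real.sqrt_sq (norm_nonneg _)]
  simp only [h1]
  have h2 : Continuous fun x : ℝ => √(RCLike.re (dirichlet T (x - x))
      - 2 * RCLike.re (dirichlet T (a - x)) + RCLike.re (dirichlet T (a - a))) := by
    have h3 : Continuous fun x : ℝ => dirichlet T (a - x) :=
      (continuous_dirichlet T).comp (by fun_prop)
    have h4 : Continuous fun x : ℝ => RCLike.re (dirichlet T (a - x)) :=
      RCLike.continuous_re.comp h3
    simp only [sub_self]
    fun_prop
  have h5 := h2.tendsto a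
  simpa [two_mul] using h5

/-! ### The quadratic form of a truncated Toeplitz operator -/

theorem integrable_exp_mul_mul {α : Type*} [MeasurableSpace α] {μ : Measure α} [SFinite μ]
    {f : ℝ → ℝ} (hf : Integrable f) {v : α → ℂ} (hv : Integrable v μ) {θ : α × ℝ → ℝ}
    (hθ : Measurable θ) :
    Integrable (fun q : α × ℝ => Complex.exp (Complex.I * θ q) * (v q.1 * (f q.2 : ℂ)))
      (μ.prod volume) := by
  refine (hv.mul_prod hf.ofReal).bdd_mul (c := 1) ?_ (ae_of_all _ fun q => ?_)
  · exact (Complex.measurable_exp.comp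
      ((Complex.measurable_ofReal.comp hθ).const_mul Complex.I)).aestronglyMeasurable
  · rw [Complex.norm_exp]
    simp

theorem toeplitz_apply_ae_integral {f : ℝ → ℝ} (hf : Integrable f) {T : ℝ} (v : L2 T) :
    toeplitz T f v =ᵐ[volume.restrict (Set.Icc (0 : ℝ) T)]
      fun t => ∫ x, (f x : ℂ) * (Complex.exp (Complex.I * x * t) * ⟪expVec T x, v⟫_ℂ) := by
  refine (toeplitz_apply_ae T f v).trans (ae_of_all _ fun t => ?_)
  have h := integrable_exp_mul_mul hf (L2.integrable v) (θ := fun q => q.2 * (t - q.1))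
    (by fun_prop)
  have h1 : ∀ s : ℝ, fourierHat f (t - s) * v s = ∫ x : ℝ,
      Complex.exp (Complex.I * ((x * (t - s) : ℝ) : ℂ)) * (v s * (f x : ℂ)) := by
    intro s
    rw [fourierHat, ← integral_mul_const]
    refine integral_congr_ae (ae_of_all _ fun x => ?_)
    simp only
    push_cast
    ring_nf
  simp only [h1]
  rw [integral_integral_swap h]
  refine integral_congr_ae (ae_of_all _ fun x => ?_)
  simp only
  rw [expVec_inner, ← integral_const_mul, ← integral_const_mul]
  refine integral_congr_ae (ae_of_all _ fun s => ?_)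
  simp only
  have h2 : Complex.exp (Complex.I * ((x * (t - s) : ℝ) : ℂ))
      = Complex.exp (Complex.I * x * t) * Complex.exp (-(Complex.I * x * s)) := by
    rw [← Complex.exp_add]
    congr 1
    push_cast
    ring
  rw [h2]
  ring

/-- The weak form of writing the operator as a superposition, with density `f`, of the rank-one
operators of the exponentials. -/
theorem inner_toeplitz {f : ℝ → ℝ} (hf : Integrable f) {T : ℝ} (hT : 0 ≤ T) (u v : L2 T) :
    ⟪u, toeplitz T f v⟫_ℂ = ∫ x, (f x : ℂ) * (⟪u, expVec T x⟫_ℂ * ⟪expVec T x, v⟫_ℂ) := by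
  have hg : Continuous fun x => ⟪expVec T x, v⟫_ℂ := (continuous_expVec T).inner continuous_const
  have hu : Integrable (fun t => starRingEnd ℂ (u t)) (volume.restrict (Set.Icc (0 : ℝ) T)) :=
    L2.integrable_conj u
  have h0 := integrable_exp_mul_mul hf hu (θ := fun q => q.2 * q.1) (by fun_prop)
  have h : Integrable (fun q : ℝ × ℝ => Complex.exp (Complex.I * ((q.2 * q.1 : ℝ) : ℂ)) *
      (starRingEnd ℂ (u q.1) * (f q.2 : ℂ)) * ⟪expVec T q.2, v⟫_ℂ)
      ((volume.restrict (Set.Icc (0 : ℝ) T)).prod volume) := by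
    refine h0.mul_bdd (c := √T * ‖v‖) (hg.comp continuous_snd).aestronglyMeasurable
      (ae_of_all _ fun q => (norm_inner_le_norm _ _).trans ?_)
    exact mul_le_mul_of_nonneg_right (norm_expVec_le hT _) (norm_nonneg _)
  rw [L2.inner_def]
  have h1 : ∫ t in Set.Icc (0 : ℝ) T, ⟪u t, toeplitz T f v t⟫_ℂ
      = ∫ t in Set.Icc (0 : ℝ) T, ∫ x, Complex.exp (Complex.I * ((x * t : ℝ) : ℂ)) *
      (starRingEnd ℂ (u t) * (f x : ℂ)) * ⟪expVec T x, v⟫_ℂ := by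
    refine integral_congr_ae ?_
    filter_upwards [toeplitz_apply_ae_integral hf v] with t ht
    rw [RCLike.inner_apply, ht, mul_comm, ← integral_const_mul]
    refine integral_congr_ae (ae_of_all _ fun x => ?_)
    simp only
    push_cast
    ring_nf
  rw [h1, integral_integral_swap h]
  refine integral_congr_ae (ae_of_all _ fun x => ?_)
  simp only
  rw [inner_expVec, ← integral_mul_const, ← integral_const_mul]
  refine integral_congr_ae (ae_of_all _ fun t => ?_)
  simp only
  push_cast
  ring_nf

/-! ### Expansion of the exponentials in a fixed sequence of vectors -/

/-- The function `t ↦ t ^ k exp (i j t)`. -/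
def powExpMap (j : ℤ) (k : ℕ) : C(ℝ, ℂ) :=
  ⟨fun t => (t : ℂ) ^ k * Complex.exp (Complex.I * (j : ℝ) * t), by fun_prop⟩

theorem norm_powExpMap_le {T t : ℝ} (ht : t ∈ Set.Icc (0 : ℝ) T) (j : ℤ) (k : ℕ) :
    ‖powExpMap j k t‖ ≤ T ^ k := by
  change ‖(t : ℂ) ^ k * Complex.exp (Complex.I * (j : ℝ) * t)‖ ≤ T ^ k
  rw [norm_mul, norm_exp_I_mul_mul, mul_one, norm_pow, Complex.norm_real,
    Real.norm_of_nonneg ht.1]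
  exact pow_le_pow_left₀ ht.1 ht.2 k

/-- The coefficient of `t ^ k exp (i j t)` in the Taylor expansion of `exp (i x t)` around the
frequency `j = ⌊x⌋`. -/
def expCoeff (j : ℤ) (k : ℕ) (x : ℝ) : ℂ :=
  if ⌊x⌋ = j then (Complex.I * (Int.fract x : ℝ)) ^ k / k.factorial else 0

theorem measurable_expCoeff (j : ℤ) (k : ℕ) : Measurable (expCoeff j k) := by
  refine Measurable.ite ?_ ?_ measurable_const
  · exact Int.measurable_floor (measurableSet_singleton j)
  · exact (((Complex.measurable_ofReal.comp measurable_fract).const_mul _).pow_const _).div_const _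

theorem norm_expCoeff_le (j : ℤ) (k : ℕ) (x : ℝ) : ‖expCoeff j k x‖ ≤ 1 / k.factorial := by
  unfold expCoeff
  split_ifs with h
  · rw [norm_div, norm_pow, norm_mul, Complex.norm_I, one_mul, Complex.norm_real,
      Real.norm_of_nonneg (Int.fract_nonneg x), Complex.norm_natCast]
    gcongr
    exact pow_le_one₀ (Int.fract_nonneg x) (Int.fract_lt_one x).le
  · simp only [norm_zero]
    positivity

theorem hasSum_expCoeff_mul (x t : ℝ) :
    HasSum (fun k => expCoeff ⌊x⌋ k x * powExpMap ⌊x⌋ k t) (Complex.exp (Complex.I * x * t)) := by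
  have h := NormedSpace.expSeries_div_hasSum_exp (Complex.I * (Int.fract x : ℝ) * t)
  rw [← Complex.exp_eq_exp_ℂ] at h
  have h2 := h.mul_right (Complex.exp (Complex.I * (⌊x⌋ : ℝ) * t))
  rw [← Complex.exp_add] at h2
  have h3 : Complex.I * (Int.fract x : ℝ) * t + Complex.I * (⌊x⌋ : ℝ) * t = Complex.I * x * t := by
    rw [← add_mul, ← mul_add, ← Complex.ofReal_add, Int.fract_add_floor]
  rw [h3] at h2
  refine h2.congr_fun ?_
  intro k
  change expCoeff ⌊x⌋ k x * ((t : ℂ) ^ k * Complex.exp (Complex.I * (⌊x⌋ : ℝ) * t)) = _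
  rw [expCoeff, if_pos rfl]
  ring

theorem hasSum_expCoeff_mul_inner {T : ℝ} (u : L2 T) (x : ℝ) :
    HasSum (fun k => expCoeff ⌊x⌋ k x * ⟪u, ofContinuous T (powExpMap ⌊x⌋ k)⟫_ℂ)
      ⟪u, expVec T x⟫_ℂ := by
  set F : ℕ → ℝ → ℂ := fun k t =>
    starRingEnd ℂ (u t) * (expCoeff ⌊x⌋ k x * powExpMap ⌊x⌋ k t) with hF
  have hu : Integrable (fun t => starRingEnd ℂ (u t)) (volume.restrict (Set.Icc (0 : ℝ) T)) :=
    L2.integrable_conj u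
  have hb : ∀ k, ∀ᵐ t ∂(volume.restrict (Set.Icc (0 : ℝ) T)),
      ‖expCoeff ⌊x⌋ k x * powExpMap ⌊x⌋ k t‖ ≤ T ^ k / k.factorial := by
    intro k
    filter_upwards [ae_restrict_mem measurableSet_Icc] with t ht
    rw [norm_mul, div_eq_inv_mul, ← one_div]
    exact mul_le_mul (norm_expCoeff_le _ _ _) (norm_powExpMap_le ht _ _) (norm_nonneg _)
      (by positivity)
  have hFi : ∀ k, Integrable (F k) (volume.restrict (Set.Icc (0 : ℝ) T)) := fun k =>
    hu.mul_bdd ((powExpMap ⌊x⌋ k).continuous.const_mul _).aestronglyMeasurable (hb k)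
  have hsum : Summable fun k => ∫ t in Set.Icc (0 : ℝ) T, ‖F k t‖ := by
    refine Summable.of_nonneg_of_le (fun k => integral_nonneg fun t => norm_nonneg _) (fun k => ?_)
      ((Real.summable_pow_div_factorial T).mul_left (∫ t in Set.Icc (0 : ℝ) T, ‖u t‖))
    rw [← integral_mul_const]
    refine integral_mono_ae (hFi k).norm ((L2.integrable u).norm.mul_const _) ?_
    filter_upwards [hb k] with t ht
    simp only [hF]
    rw [norm_mul, RCLike.norm_conj]
    exact mul_le_mul_of_nonneg_left ht (norm_nonneg _)
  have h := hasSum_integral_of_summable_integral_norm hFi hsum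
  have h1 : ∀ t, ∑' k, F k t = starRingEnd ℂ (u t) * Complex.exp (Complex.I * x * t) := fun t =>
    ((hasSum_expCoeff_mul x t).mul_left _).tsum_eq
  simp only [h1] at h
  rw [inner_expVec]
  refine h.congr_fun fun k => ?_
  rw [inner_ofContinuous, ← integral_const_mul]
  refine integral_congr_ae (ae_of_all _ fun t => ?_)
  simp only [hF]
  ring

/-- All exponentials are absolutely convergent combinations of one sequence of vectors. -/
theorem exists_expVec_expansion {T : ℝ} (hT : 0 ≤ T) :
    ∃ (c : ℕ → ℝ → ℂ) (ψ : ℕ → L2 T) (C : ℝ), (∀ k, Measurable (c k)) ∧ (∀ k x, ‖c k x‖ ≤ 1) ∧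
      (∀ (s : Finset ℕ) x, ∑ k ∈ s, ‖c k x‖ * ‖ψ k‖ ≤ C) ∧
      ∀ (u : L2 T) x, HasSum (fun k => c k x * ⟪u, ψ k⟫_ℂ) ⟪u, expVec T x⟫_ℂ := by
  have e : ℕ ≃ ℤ × ℕ := (Denumerable.eqv (ℤ × ℕ)).symm
  have hinj : ∀ x : ℝ, Function.Injective fun k : ℕ => e.symm (⌊x⌋, k) := fun x k l h => by
    simpa using h
  have hout : ∀ x : ℝ, ∀ k ∉ Set.range (fun k : ℕ => e.symm (⌊x⌋, k)),
      expCoeff (e k).1 (e k).2 x = 0 := by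
    intro x k hk
    rw [expCoeff, if_neg]
    intro h
    exact hk ⟨(e k).2, by simp only [h, Prod.mk.eta, Equiv.symm_apply_apply]⟩
  -- At a given `x` only the indices with `j = ⌊x⌋` contribute. Expanding around `⌊x⌋` keeps the
  -- increment of frequency below one, so the bound is uniform over all of `ℝ`.
  have hsum : ∀ x : ℝ, HasSum (fun k => ‖expCoeff (e k).1 (e k).2 x‖ *
      ‖ofContinuous T (powExpMap (e k).1 (e k).2)‖)
      (∑' k, ‖expCoeff ⌊x⌋ k x‖ * ‖ofContinuous T (powExpMap ⌊x⌋ k)‖) ∧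
      ∑' k, ‖expCoeff ⌊x⌋ k x‖ * ‖ofContinuous T (powExpMap ⌊x⌋ k)‖
      ≤ ∑' k, √T * (T ^ k / k.factorial) := by
    intro x
    have hle : ∀ k, ‖expCoeff ⌊x⌋ k x‖ * ‖ofContinuous T (powExpMap ⌊x⌋ k)‖
        ≤ √T * (T ^ k / k.factorial) := by
      intro k
      refine (mul_le_mul (norm_expCoeff_le _ _ _) (norm_ofContinuous_le hT _ (by positivity)
        fun t ht => norm_powExpMap_le ht _ _) (norm_nonneg _) (by positivity)).trans (le_of_eq ?_)
      ring
    have hs := (Real.summable_pow_div_factorial T).mul_left √T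
    have hs' := Summable.of_nonneg_of_le (fun k => by positivity) hle hs
    refine ⟨?_, hs'.tsum_le_tsum hle hs⟩
    rw [← (hinj x).hasSum_iff fun k hk => by rw [hout x k hk, norm_zero, zero_mul]]
    simpa [Function.comp_def] using hs'.hasSum
  refine ⟨fun k => expCoeff (e k).1 (e k).2, fun k => ofContinuous T (powExpMap (e k).1 (e k).2),
    ∑' k, √T * (T ^ k / k.factorial), fun k => measurable_expCoeff _ _, fun k x => ?_,
    fun s x => ?_, fun u x => ?_⟩
  · refine (norm_expCoeff_le _ _ _).trans ?_
    rw [div_le_one (by positivity)]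
    exact_mod_cast Nat.one_le_iff_ne_zero.2 (Nat.factorial_ne_zero _)
  · exact (sum_le_hasSum s (fun k _ => by positivity) (hsum x).1).trans (hsum x).2
  · rw [← (hinj x).hasSum_iff fun k hk => by simp only [hout x k hk, zero_mul]]
    simpa [Function.comp_def] using hasSum_expCoeff_mul_inner u x

/-! ### Trace class property and the trace of a product -/

/-- Left multiplication by a truncated Toeplitz operator gives trace class operators, and the
trace is an integral over frequencies. -/
theorem isTraceClass_toeplitz_mul {f : ℝ → ℝ} (hf : Integrable f) {T : ℝ} (hT : 0 ≤ T)
    (A : L2 T →L[ℂ] L2 T) :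
    IsTraceClass (toeplitz T f * A) ∧
      trace (toeplitz T f * A) = ∫ x, (f x : ℂ) * ⟪expVec T x, A (expVec T x)⟫_ℂ := by
  obtain ⟨c, ψ, C, hcm, hc1, hcs, hexp⟩ := exists_expVec_expansion hT
  have hfc : ∀ k, Integrable fun x => |f x| * ‖c k x‖ := fun k =>
    hf.abs.mul_bdd (c := 1) (hcm k).norm.aestronglyMeasurable
      (ae_of_all _ fun x => by simpa using hc1 k x)
  -- The bound on `∑ ‖c k x‖ ‖ψ k‖`, uniform in `x`, is integrated against `|f|`.
  have hfs : Summable fun k => (∫ x, |f x| * ‖c k x‖) * ‖ψ k‖ := by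
    refine summable_of_sum_le (c := (∫ x, |f x|) * C)
      (fun k => mul_nonneg (integral_nonneg fun x => by positivity) (norm_nonneg _)) fun s => ?_
    simp only [← integral_mul_const]
    rw [← integral_finsetSum _ fun k _ => (hfc k).mul_const _]
    refine integral_mono (integrable_finsetSum _ fun k _ => (hfc k).mul_const _)
      (hf.abs.mul_const _) fun x => ?_
    simp only [mul_assoc]
    rw [← Finset.mul_sum]
    exact mul_le_mul_of_nonneg_left (hcs s x) (abs_nonneg _)
  -- The vector `u` may vary with `x`: a multiple of a fixed vector gives the nuclear
  -- representation, and `u x = A' (expVec T x)` gives the trace.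
  have hswap : ∀ (u : ℝ → L2 T), Continuous u → ∀ D : ℝ, 0 ≤ D → (∀ x, ‖u x‖ ≤ D) →
      HasSum (fun k => ∫ x, (f x : ℂ) * (c k x * ⟪u x, ψ k⟫_ℂ))
        (∫ x, (f x : ℂ) * ⟪u x, expVec T x⟫_ℂ) := by
    intro u hu D hD0 hD
    have hb : ∀ k x, ‖(f x : ℂ) * (c k x * ⟪u x, ψ k⟫_ℂ)‖ ≤ |f x| * ‖c k x‖ * (D * ‖ψ k‖) := by
      intro k x
      rw [norm_mul, norm_mul, Complex.norm_real, Real.norm_eq_abs, mul_assoc]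
      gcongr
      exact (norm_inner_le_norm _ _).trans (mul_le_mul_of_nonneg_right (hD x) (norm_nonneg _))
    have hi : ∀ k, Integrable fun x => (f x : ℂ) * (c k x * ⟪u x, ψ k⟫_ℂ) := fun k =>
      ((hfc k).mul_const (D * ‖ψ k‖)).mono' (hf.ofReal.1.mul ((hcm k).aestronglyMeasurable.mul
        (hu.inner continuous_const).aestronglyMeasurable)) (ae_of_all _ fun x => hb k x)
    have h := hasSum_integral_of_summable_integral_norm hi (by
      refine Summable.of_nonneg_of_le (fun k => integral_nonneg fun x => norm_nonneg _)
        (fun k => ?_) (hfs.mul_right D)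
      refine (integral_mono (hi k).norm ((hfc k).mul_const (D * ‖ψ k‖)) (hb k)).trans
        (le_of_eq ?_)
      rw [integral_mul_const]
      ring)
    have h1 : ∀ x, ∑' k, (f x : ℂ) * (c k x * ⟪u x, ψ k⟫_ℂ) = (f x : ℂ) * ⟪u x, expVec T x⟫_ℂ :=
      fun x => ((hexp (u x) x).mul_left _).tsum_eq
    simpa only [h1] using h
  -- Expanding one of the two exponentials in `∫ f(x) e_x ⊗ e_x dx` along the `ψ k` leaves `ξ k` as
  -- the other leg; the conjugate is due to antilinearity in the first slot.
  set ξ : ℕ → L2 T := fun k => ∫ x, ((f x : ℂ) * starRingEnd ℂ (c k x)) • expVec T x with hξ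
  have hξb : ∀ k x, ‖((f x : ℂ) * starRingEnd ℂ (c k x)) • expVec T x‖ ≤ |f x| * ‖c k x‖ * √T := by
    intro k x
    rw [norm_smul, norm_mul, RCLike.norm_conj, Complex.norm_real, Real.norm_eq_abs]
    gcongr
    exact norm_expVec_le hT x
  have hξi : ∀ k, Integrable fun x => ((f x : ℂ) * starRingEnd ℂ (c k x)) • expVec T x := fun k =>
    ((hfc k).mul_const √T).mono' ((hf.ofReal.1.mul
      (RCLike.continuous_conj.measurable.comp (hcm k)).aestronglyMeasurable).smul
        (continuous_expVec T).aestronglyMeasurable) (ae_of_all _ fun x => hξb k x)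
  have hξn : ∀ k, ‖ξ k‖ ≤ (∫ x, |f x| * ‖c k x‖) * √T := by
    intro k
    rw [← integral_mul_const]
    exact norm_integral_le_of_norm_le ((hfc k).mul_const √T) (ae_of_all _ fun x => hξb k x)
  have hξin : ∀ k v, ⟪ξ k, v⟫_ℂ = ∫ x, (f x : ℂ) * (c k x * ⟪expVec T x, v⟫_ℂ) := by
    intro k v
    rw [← inner_conj_symm, hξ, ← integral_inner (hξi k), ← integral_conj]
    refine integral_congr_ae (ae_of_all _ fun x => ?_)
    simp only [inner_smul_right, map_mul, Complex.conj_ofReal, Complex.conj_conj, inner_conj_symm,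
      mul_assoc]
  set A' := ContinuousLinearMap.adjoint A with hA'
  have hxy : Summable fun k => ‖A' (ξ k)‖ * ‖ψ k‖ := by
    refine Summable.of_nonneg_of_le (fun k => by positivity) (fun k => ?_)
      (hfs.mul_left (‖A'‖ * √T))
    calc ‖A' (ξ k)‖ * ‖ψ k‖ ≤ (‖A'‖ * ((∫ x, |f x| * ‖c k x‖) * √T)) * ‖ψ k‖ := by
          gcongr
          exact (A'.le_opNorm _).trans (by gcongr; exact hξn k)
      _ = _ := by ring
  have hrep : ∀ v, HasSum (fun k => ⟪A' (ξ k), v⟫_ℂ • ψ k) ((toeplitz T f * A) v) := by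
    intro v
    have hs : Summable fun k => ⟪A' (ξ k), v⟫_ℂ • ψ k := by
      refine Summable.of_norm (Summable.of_nonneg_of_le (fun k => norm_nonneg _) (fun k => ?_)
        (hxy.mul_left ‖v‖))
      rw [norm_smul]
      calc ‖⟪A' (ξ k), v⟫_ℂ‖ * ‖ψ k‖ ≤ (‖A' (ξ k)‖ * ‖v‖) * ‖ψ k‖ := by
            gcongr; exact norm_inner_le_norm _ _
        _ = _ := by ring
    convert hs.hasSum using 1
    refine ext_inner_left ℂ fun u => ?_
    have h1 : HasSum (fun k => ⟪u, ⟪A' (ξ k), v⟫_ℂ • ψ k⟫_ℂ)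
        ⟪u, ∑' k, ⟪A' (ξ k), v⟫_ℂ • ψ k⟫_ℂ := by
      exact (innerSL ℂ u).hasSum hs.hasSum
    have hAv : Continuous fun x => ⟪A v, expVec T x⟫_ℂ :=
      continuous_const.inner (continuous_expVec T)
    -- The scalar is conjugated in the first slot, which produces the missing factor `⟪expVec T x, A
    -- v⟫`.
    have h2 := hswap (fun x => ⟪A v, expVec T x⟫_ℂ • u) (hAv.smul continuous_const)
      (‖A v‖ * √T * ‖u‖) (by positivity) (fun x => by
        rw [norm_smul]
        gcongr
        exact (norm_inner_le_norm _ _).trans (by gcongr; exact norm_expVec_le hT x))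
    simp only [inner_smul_left, inner_conj_symm] at h2
    change ⟪u, toeplitz T f (A v)⟫_ℂ = _
    rw [inner_toeplitz hf hT]
    refine HasSum.unique (f := fun k => ⟪u, ⟪A' (ξ k), v⟫_ℂ • ψ k⟫_ℂ) ?_ h1
    convert h2 using 1
    · funext k
      rw [inner_smul_right, hA', ContinuousLinearMap.adjoint_inner_left, hξin,
        ← integral_mul_const]
      refine integral_congr_ae (ae_of_all _ fun x => ?_)
      simp only
      ring
    · refine integral_congr_ae (ae_of_all _ fun x => ?_)
      simp only
      ring
  refine ⟨⟨_, _, hxy, hrep⟩, ?_⟩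
  rw [trace_eq_tsum_inner hxy hrep]
  have h := hswap (fun x => A' (expVec T x)) (A'.continuous.comp (continuous_expVec T))
    (‖A'‖ * √T) (by positivity)
    (fun x => (A'.le_opNorm _).trans (by gcongr; exact norm_expVec_le hT x))
  simp only [hA', ContinuousLinearMap.adjoint_inner_left] at h
  rw [← h.tsum_eq]
  refine tsum_congr fun k => ?_
  rw [hA', ContinuousLinearMap.adjoint_inner_left, hξin]

/-! ### Traces of products as integrals over closed paths -/

theorem integrable_prod_mul_prod_dirichlet_steps {n : ℕ} {g : Fin n → ℝ → ℝ}
    (hg : ∀ i, Integrable (g i)) {T : ℝ} (hT : 0 ≤ T) (a b : ℝ) :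
    Integrable fun y : Fin n → ℝ =>
      (∏ i, (g i (y i) : ℂ)) * ∏ k, dirichlet T (steps a y b k) := by
  have h : Integrable fun y : Fin n → ℝ => ∏ i, (g i (y i) : ℂ) := by
    rw [volume_pi]
    exact Integrable.fintype_prod (f := fun i x => (g i x : ℂ)) fun i => (hg i).ofReal
  exact h.mul_bdd (continuous_prod_dirichlet_steps_path T a b).aestronglyMeasurable
    (ae_of_all _ fun y => norm_prod_dirichlet_steps_le hT a b y)

/-- Each operator inserts one frequency, and each pair of consecutive frequencies pairs to a
Dirichlet kernel at their difference. -/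
theorem inner_expVec_prod_toeplitz {n : ℕ} {g : Fin n → ℝ → ℝ} (hg : ∀ i, Integrable (g i))
    {T : ℝ} (hT : 0 ≤ T) (a b : ℝ) :
    ⟪expVec T a, (List.ofFn fun i => toeplitz T (g i)).prod (expVec T b)⟫_ℂ
      = ∫ y : Fin n → ℝ, (∏ i, (g i (y i) : ℂ)) * ∏ k, dirichlet T (steps a y b k) := by
  induction n generalizing a with
  | zero =>
    simp only [volume_fin_zero, integral_dirac, Fin.prod_univ_zero, one_mul, Fin.prod_univ_succ,
      steps_zero_dim, mul_one, List.ofFn_zero, List.prod_nil]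
    exact inner_expVec_expVec T a b
  | succ n ih =>
    rw [List.ofFn_succ, List.prod_cons,
      integral_fin_succ (integrable_prod_mul_prod_dirichlet_steps hg hT a b)]
    change ⟪expVec T a, toeplitz T (g 0)
      ((List.ofFn fun i : Fin n => toeplitz T (g i.succ)).prod (expVec T b))⟫_ℂ = _
    rw [inner_toeplitz (hg 0) hT]
    refine integral_congr_ae (ae_of_all _ fun x => ?_)
    simp only [Fin.prod_univ_succ (n := n + 1), Fin.prod_univ_succ (n := n), steps_cons_zero,
      steps_cons_succ, Fin.cons_zero, Fin.cons_succ]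
    rw [ih (fun i => hg i.succ) x, inner_expVec_expVec, ← integral_const_mul, ← integral_const_mul]
    refine integral_congr_ae (ae_of_all _ fun y => ?_)
    simp only [Fin.prod_univ_succ (n := n)]
    ring

theorem isTraceClass_toeplitzProd {n : ℕ} {h : Fin (n + 1) → ℝ → ℝ} (hint : ∀ i, Integrable (h i))
    {T : ℝ} (hT : 0 ≤ T) : IsTraceClass (toeplitzProd h T) := by
  rw [toeplitzProd, List.ofFn_succ, List.prod_cons]
  exact (isTraceClass_toeplitz_mul (hint 0) hT _).1

theorem trace_toeplitzProd {n : ℕ} {h : Fin (n + 1) → ℝ → ℝ} (hint : ∀ i, Integrable (h i))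
    {T : ℝ} (hT : 0 ≤ T) :
    trace (toeplitzProd h T) = ∫ x, (h 0 x : ℂ) * ∫ y : Fin n → ℝ,
      (∏ i, (h i.succ (y i) : ℂ)) * ∏ k, dirichlet T (steps x y x k) := by
  rw [toeplitzProd, List.ofFn_succ, List.prod_cons, (isTraceClass_toeplitz_mul (hint 0) hT _).2]
  simp only [inner_expVec_prod_toeplitz (fun i => hint i.succ) hT]

/-! ### From closed paths to the correlation function -/

theorem measurePreserving_shear (n : ℕ) :
    MeasurePreserving fun q : ℝ × (Fin n → ℝ) => (q.1, fun i => q.1 + q.2 i) := by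
  refine (MeasurePreserving.id volume).skew_product (g := fun (x : ℝ) (z : Fin n → ℝ) i => x + z i)
    ?_ (ae_of_all _ fun x => ?_)
  · unfold Function.uncurry
    fun_prop
  · exact map_add_left_eq_self (volume : Measure (Fin n → ℝ)) fun _ => x

theorem integrable_mul_prod_shear {n : ℕ} {h : Fin (n + 1) → ℝ → ℝ}
    (hint : ∀ i, Integrable (h i)) :
    Integrable fun q : ℝ × (Fin n → ℝ) => h 0 q.1 * ∏ i : Fin n, h i.succ (q.1 + q.2 i) := by
  have h1 : Integrable fun y : Fin n → ℝ => ∏ i : Fin n, h i.succ (y i) := by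
    rw [volume_pi]
    exact Integrable.fintype_prod (f := fun i : Fin n => h i.succ) fun i => hint i.succ
  exact (measurePreserving_shear n).integrable_comp_of_integrable ((hint 0).mul_prod h1)

/-- Path vertices are `x + z i`, whereas `phi` translates by `x - u i`; hence the argument `-z`
below. -/
theorem phi_neg {n : ℕ} (h : Fin (n + 1) → ℝ → ℝ) (z : Fin n → ℝ) :
    phi h (-z) = ∫ x, h 0 x * ∏ i : Fin n, h i.succ (x + z i) := by
  simp [phi]

theorem integrable_phi_neg {n : ℕ} {h : Fin (n + 1) → ℝ → ℝ} (hint : ∀ i, Integrable (h i)) :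
    Integrable fun z => phi h (-z) := by
  simp only [phi_neg]
  exact (integrable_mul_prod_shear hint).integral_prod_right

/-- Increments do not see a translation of the loop, so the kernel depends only on the vertices
relative to the base point, and integrating over the base point yields the correlation function. -/
theorem S_eq_integral_phi {n : ℕ} {h : Fin (n + 1) → ℝ → ℝ} (hint : ∀ i, Integrable (h i))
    {T : ℝ} (hT : 0 ≤ T) :
    S h T = (1 / (T : ℂ)) *
      ∫ z : Fin n → ℝ, (phi h (-z) : ℂ) * ∏ k, dirichlet T (steps 0 z 0 k) := by
  rw [S, trace_toeplitzProd hint hT]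
  congr 1
  have h1 : ∀ x : ℝ, ∫ y : Fin n → ℝ,
      (∏ i, (h i.succ (y i) : ℂ)) * ∏ k, dirichlet T (steps x y x k)
      = ∫ z : Fin n → ℝ, (∏ i, (h i.succ (x + z i) : ℂ)) * ∏ k, dirichlet T (steps 0 z 0 k) := by
    intro x
    rw [← integral_add_left_eq_self (μ := (volume : Measure (Fin n → ℝ))) _ (fun _ : Fin n => x)]
    refine integral_congr_ae (ae_of_all _ fun z => ?_)
    have h2 := fun k => steps_const_add x 0 0 z k
    simp only [add_zero] at h2
    simp only [← h2]
    rfl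
  have h3 : Integrable (fun q : ℝ × (Fin n → ℝ) =>
      ((h 0 q.1 * ∏ i : Fin n, h i.succ (q.1 + q.2 i) : ℝ) : ℂ) *
        ∏ k, dirichlet T (steps 0 q.2 0 k)) (volume.prod volume) :=
    (integrable_mul_prod_shear hint).ofReal.mul_bdd
      ((continuous_prod_dirichlet_steps_path T 0 0).comp continuous_snd).aestronglyMeasurable
      (ae_of_all _ fun q => norm_prod_dirichlet_steps_le hT 0 0 q.2)
  have h4 := integral_integral_swap (f := fun (x : ℝ) (z : Fin n → ℝ) =>
    ((h 0 x * ∏ i : Fin n, h i.succ (x + z i) : ℝ) : ℂ) * ∏ k, dirichlet T (steps 0 z 0 k)) h3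
  simp only [h1, phi_neg]
  refine Eq.trans ?_ (h4.trans ?_)
  · refine integral_congr_ae (ae_of_all _ fun x => ?_)
    simp only
    rw [← integral_const_mul]
    refine integral_congr_ae (ae_of_all _ fun z => ?_)
    simp only
    push_cast
    ring
  · refine integral_congr_ae (ae_of_all _ fun z => ?_)
    simp only
    rw [integral_mul_const, integral_complex_ofReal]

theorem M_eq {n : ℕ} (h : Fin (n + 1) → ℝ → ℝ) : M h = (2 * Real.pi) ^ n * phi h 0 := by
  simp [M, phi, Fin.prod_univ_succ]

theorem tendsto_Delta_iff {n : ℕ} (h : Fin (n + 1) → ℝ → ℝ) :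
    Tendsto (Delta h) atTop (𝓝 0) ↔ Tendsto (S h) atTop (𝓝 (M h : ℂ)) :=
  tendsto_iff_norm_sub_tendsto_zero.symm

/-- Continuity at the origin and integrability of the correlation function `phi` give the trace
approximation. -/
theorem tendsto_Delta_of_phi {m : ℕ} {h : Fin (m + 1 + 1) → ℝ → ℝ} (hint : ∀ i, Integrable (h i))
    (hphi : MemLp (phi h) (m : ℝ≥0∞) volume) (h0 : ContinuousAt (phi h) 0) :
    Tendsto (Delta h) atTop (𝓝 0) := by
  rw [tendsto_Delta_iff, M_eq]
  have hneg : MemLp (fun z => phi h (-z)) (m : ℝ≥0∞) volume :=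
    hphi.comp_measurePreserving (Measure.measurePreserving_neg volume)
  have hc : ContinuousAt (fun z => phi h (-z)) 0 :=
    ContinuousAt.comp (g := phi h) (f := fun z => -z) (by rwa [neg_zero]) continuousAt_neg
  have hmain := tendsto_integral_mul_prod_dirichlet (integrable_phi_neg hint) hneg hc
  rw [neg_zero] at hmain
  push_cast
  refine hmain.congr' ?_
  filter_upwards [eventually_ge_atTop 0] with T hT
  exact (S_eq_integral_phi hint hT).symm

/-- The loop has a single increment, zero, where the Dirichlet kernel equals `T`; the error vanishes
for every `T > 0`. -/
theorem tendsto_Delta_of_unique {h : Fin 1 → ℝ → ℝ} (hint : ∀ i, Integrable (h i)) :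
    Tendsto (Delta h) atTop (𝓝 0) := by
  rw [tendsto_Delta_iff, M_eq]
  refine tendsto_const_nhds.congr' ?_
  filter_upwards [eventually_gt_atTop 0] with T hT
  have hTc : (T : ℂ) ≠ 0 := by exact_mod_cast hT.ne'
  rw [S_eq_integral_phi hint hT.le]
  simp only [volume_fin_zero, integral_dirac, Fin.prod_univ_succ, Fin.prod_univ_zero,
    steps_zero_dim, sub_self, dirichlet_zero hT.le, neg_zero]
  field_simp

/-! ### Products of functions in Lebesgue spaces -/

section

variable {α : Type*} [MeasurableSpace α] {μ : Measure α}

theorem memLp_of_integrable_of_bound {g : α → ℝ} (hg : Integrable g μ) (hb : ∀ x, |g x| ≤ 1)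
    {r : ℝ≥0∞} (hr : 1 ≤ r) : MemLp g r μ := by
  rcases eq_or_ne r ∞ with rfl | hr'
  · exact memLp_top_of_bound hg.1 1 (ae_of_all _ hb)
  · refine ⟨hg.1, ?_⟩
    have hr0 : r ≠ 0 := (zero_lt_one.trans_le hr).ne'
    rw [eLpNorm_lt_top_iff_lintegral_rpow_enorm_lt_top hr0 hr']
    refine lt_of_le_of_lt (lintegral_mono fun x => ?_) hg.2
    have h1 : ‖g x‖ₑ ≤ 1 := by
      rw [← ofReal_norm, ← ENNReal.ofReal_one]
      exact ENNReal.ofReal_le_ofReal (hb x)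
    have h2 : 1 ≤ r.toReal := by
      rw [← ENNReal.toReal_one]
      exact ENNReal.toReal_mono hr' hr
    simpa using ENNReal.rpow_le_rpow_of_exponent_ge h1 h2

/-- Cut at height one: the low part is integrable and bounded, and the high part lives on a set of
finite measure, where a larger exponent controls a smaller one. -/
theorem memLp_of_integrable_of_memLp {g : α → ℝ} {p r : ℝ≥0∞} (hg : Integrable g μ)
    (hp : MemLp g p μ) (hr : 1 ≤ r) (hrp : r ≤ p) : MemLp g r μ := by
  have ht : Integrable (fun x => trunc 1 (g x)) μ :=
    memLp_one_iff_integrable.1 (memLp_trunc (memLp_one_iff_integrable.2 hg) 1)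
  have h1 : MemLp (fun x => trunc 1 (g x)) r μ :=
    memLp_of_integrable_of_bound ht (fun x => abs_trunc_le zero_le_one _) hr
  have h2 : MemLp (fun x => g x - trunc 1 (g x)) r μ := by
    refine (hp.sub (memLp_trunc hp 1)).mono_exponent_of_measure_support_ne_top
      (s := {x | 1 ≤ ‖g x‖}) (fun x hx => ?_) (hg.measure_norm_ge_lt_top zero_lt_one).ne hrp
    have h3 : |g x| ≤ 1 := le_of_lt (not_le.1 hx)
    simp [trunc_of_le h3]
  have h3 := h2.add h1
  refine h3.ae_eq (ae_of_all _ fun x => ?_)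
  simp

variable {ι : Type*} {s : Finset ι} {p : ι → ℝ≥0∞} {a b : ι → α → ℝ}

theorem eLpNorm_prod_le (ha : ∀ i ∈ s, AEStronglyMeasurable (a i) μ) :
    eLpNorm (∏ i ∈ s, a i) (∑ i ∈ s, (p i)⁻¹)⁻¹ μ ≤ ∏ i ∈ s, eLpNorm (a i) (p i) μ := by
  classical
  induction s using Finset.cons_induction with
  | empty =>
    simp only [Finset.prod_empty, Finset.sum_empty, ENNReal.inv_zero, eLpNorm_exponent_top]
    exact eLpNormEssSup_le_of_ae_enorm_bound (ae_of_all _ fun x => by simp)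
  | cons i s hi ih =>
    rw [Finset.prod_cons, Finset.prod_cons]
    have hs : AEStronglyMeasurable (∏ j ∈ s, a j) μ :=
      Finset.aestronglyMeasurable_prod s fun j hj => ha j (Finset.mem_cons_of_mem hj)
    have : ENNReal.HolderTriple (p i) (∑ j ∈ s, (p j)⁻¹)⁻¹ (∑ j ∈ Finset.cons i s hi, (p j)⁻¹)⁻¹ :=
      ⟨by simp only [inv_inv, Finset.sum_cons]⟩
    refine (eLpNorm_smul_le_mul_eLpNorm (p := p i) (q := (∑ j ∈ s, (p j)⁻¹)⁻¹) hs
      (ha i (Finset.mem_cons_self i s))).trans ?_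
    exact mul_le_mul_right (ih fun j hj => ha j (Finset.mem_cons_of_mem hj)) _

/-- Telescoping, with Hölder's inequality for each term. The bound on the sum of inverses makes the
target exponent at least one, so the triangle inequality is available; `1 ≤ C` allows a common power
of `C`. -/
theorem eLpNorm_prod_sub_prod_le (ha : ∀ i ∈ s, AEStronglyMeasurable (a i) μ)
    (hb : ∀ i ∈ s, AEStronglyMeasurable (b i) μ) (hp : ∑ i ∈ s, (p i)⁻¹ ≤ 1)
    {C : ℝ≥0∞} (hC : 1 ≤ C) (haC : ∀ i ∈ s, eLpNorm (a i) (p i) μ ≤ C)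
    (hbC : ∀ i ∈ s, eLpNorm (b i) (p i) μ ≤ C) :
    eLpNorm (∏ i ∈ s, a i - ∏ i ∈ s, b i) (∑ i ∈ s, (p i)⁻¹)⁻¹ μ
      ≤ C ^ s.card * ∑ i ∈ s, eLpNorm (a i - b i) (p i) μ := by
  classical
  induction s using Finset.cons_induction with
  | empty => simp
  | cons i s hi ih =>
    have hi' : i ∈ Finset.cons i s hi := Finset.mem_cons_self i s
    have hm : ∀ j ∈ s, j ∈ Finset.cons i s hi := fun j hj => Finset.mem_cons_of_mem hj
    have has : AEStronglyMeasurable (∏ j ∈ s, a j) μ :=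
      Finset.aestronglyMeasurable_prod s fun j hj => ha j (hm j hj)
    have hbs : AEStronglyMeasurable (∏ j ∈ s, b j) μ :=
      Finset.aestronglyMeasurable_prod s fun j hj => hb j (hm j hj)
    have hT : ENNReal.HolderTriple (p i) (∑ j ∈ s, (p j)⁻¹)⁻¹
        (∑ j ∈ Finset.cons i s hi, (p j)⁻¹)⁻¹ := ⟨by simp only [inv_inv, Finset.sum_cons]⟩
    have hps : ∑ j ∈ s, (p j)⁻¹ ≤ 1 := by
      refine le_trans ?_ hp
      rw [Finset.sum_cons]
      exact le_add_self
    have hprod : eLpNorm (∏ j ∈ s, a j) (∑ j ∈ s, (p j)⁻¹)⁻¹ μ ≤ C ^ s.card := by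
      refine (eLpNorm_prod_le fun j hj => ha j (hm j hj)).trans ?_
      exact Finset.prod_le_pow_card s _ C fun j hj => haC j (hm j hj)
    have hsplit : ∏ j ∈ Finset.cons i s hi, a j - ∏ j ∈ Finset.cons i s hi, b j
        = (a i - b i) • ∏ j ∈ s, a j + b i • (∏ j ∈ s, a j - ∏ j ∈ s, b j) := by
      rw [Finset.prod_cons, Finset.prod_cons, smul_eq_mul, smul_eq_mul]
      ring
    simp only [Finset.sum_cons] at hp hT
    simp only [hsplit, Finset.sum_cons, Finset.card_cons]
    refine (eLpNorm_add_le (((ha i hi').sub (hb i hi')).smul has) ((hb i hi').smul (has.sub hbs))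
      (by rwa [ENNReal.one_le_inv])).trans ?_
    rw [mul_add]
    refine add_le_add ?_ ?_
    · refine (eLpNorm_smul_le_mul_eLpNorm (p := p i) (q := (∑ j ∈ s, (p j)⁻¹)⁻¹) has
        ((ha i hi').sub (hb i hi'))).trans ?_
      rw [mul_comm]
      refine mul_le_mul_left (hprod.trans ?_) _
      exact pow_le_pow_right₀ hC (Nat.le_succ _)
    · refine (eLpNorm_smul_le_mul_eLpNorm (p := p i) (q := (∑ j ∈ s, (p j)⁻¹)⁻¹) (has.sub hbs)
        (hb i hi')).trans ?_
      refine (mul_le_mul' (hbC i hi') (ih (fun j hj => ha j (hm j hj)) (fun j hj => hb j (hm j hj))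
        hps (fun j hj => haC j (hm j hj)) fun j hj => hbC j (hm j hj))).trans (le_of_eq ?_)
      rw [pow_succ]
      ring

end

/-! ### Translations -/

theorem eLpNorm_comp_sub (g : ℝ → ℝ) (hg : AEStronglyMeasurable g volume) (p : ℝ≥0∞) (v : ℝ) :
    eLpNorm (fun x => g (x - v)) p volume = eLpNorm g p volume :=
  eLpNorm_comp_measurePreserving hg (measurePreserving_sub_right volume v)

theorem tendsto_eLpNorm_translate_sub {p : ℝ≥0∞} (hp1 : 1 ≤ p) (hp : p ≠ ∞) {g : ℝ → ℝ}
    (hg : MemLp g p volume) :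
    Tendsto (fun v : ℝ => eLpNorm ((fun x => g (x - v)) - g) p volume) (𝓝 0) (𝓝 0) := by
  have : Fact (1 ≤ p) := ⟨hp1⟩
  let τ : C(ℝ, C(ℝ, ℝ)) := ContinuousMap.curry ⟨fun q : ℝ × ℝ => q.2 - q.1, by fun_prop⟩
  have hτ : ∀ v, MeasurePreserving (τ v) := fun v => measurePreserving_sub_right volume v
  have h := Filter.Tendsto.compMeasurePreservingLp (l := 𝓝 (0 : ℝ)) (f := fun _ => hg.toLp g)
    (f₀ := hg.toLp g) (g := fun v => τ v) (g₀ := τ 0) tendsto_const_nhds (τ.continuous.tendsto 0)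
    hτ (hτ 0) hp
  have h2 := tendsto_iff_edist_tendsto_0.1 h
  refine h2.congr fun v => ?_
  rw [Lp.edist_def]
  refine eLpNorm_congr_ae ?_
  have h3 : ∀ v, Lp.compMeasurePreserving (τ v) (hτ v) (hg.toLp g) =ᵐ[volume]
      fun x => g (x - v) := fun v =>
    (Lp.coeFn_compMeasurePreserving _ (hτ v)).trans
      ((hτ v).quasiMeasurePreserving.ae_eq_comp hg.coeFn_toLp)
  filter_upwards [h3 v, h3 0] with x hx hx0
  simp only [Pi.sub_apply, hx, hx0, sub_zero]

/-! ### The correlation function under a Hölder condition -/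

/-- The translations entering `phi h u`. -/
def translates {n : ℕ} (h : Fin (n + 1) → ℝ → ℝ) (u : Fin n → ℝ) (i : Fin (n + 1)) (x : ℝ) : ℝ :=
  h i (x - (Fin.cons 0 u : Fin (n + 1) → ℝ) i)

theorem phi_eq_integral_prod_translates {n : ℕ} (h : Fin (n + 1) → ℝ → ℝ) (u : Fin n → ℝ) :
    phi h u = ∫ x, (∏ i, translates h u i) x := by
  simp [phi, translates, Fin.prod_univ_succ]

section

variable {n : ℕ} {h : Fin (n + 1) → ℝ → ℝ} {p : Fin (n + 1) → ℝ≥0∞}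

theorem memLp_translates {r : ℝ≥0∞} {i : Fin (n + 1)} (hm : MemLp (h i) r volume)
    (u : Fin n → ℝ) : MemLp (translates h u i) r volume :=
  hm.comp_measurePreserving (measurePreserving_sub_right volume _)

theorem integrable_prod_translates (hp : ∑ i, (p i)⁻¹ = 1) (hm : ∀ i, MemLp (h i) (p i) volume)
    (u : Fin n → ℝ) : Integrable (∏ i, translates h u i) := by
  have h1 := MemLp.prod (s := Finset.univ) fun i _ => memLp_translates (hm i) u
  rw [hp, inv_one] at h1
  exact memLp_one_iff_integrable.1 h1

/-- Serves twice: with `h' = h` for continuity, and with `w = u` for approximation uniform in `u`.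
-/
theorem abs_phi_sub_phi_le {h' : Fin (n + 1) → ℝ → ℝ} (hp : ∑ i, (p i)⁻¹ = 1)
    (hm : ∀ i, MemLp (h i) (p i) volume) (hm' : ∀ i, MemLp (h' i) (p i) volume)
    {C : ℝ≥0∞} (hC : 1 ≤ C) (hmC : ∀ i, eLpNorm (h i) (p i) volume ≤ C)
    (hmC' : ∀ i, eLpNorm (h' i) (p i) volume ≤ C) (u w : Fin n → ℝ) :
    ‖phi h u - phi h' w‖ₑ ≤
      C ^ (n + 1) * ∑ i, eLpNorm (translates h u i - translates h' w i) (p i) volume := by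
  rw [phi_eq_integral_prod_translates, phi_eq_integral_prod_translates,
    ← integral_sub (integrable_prod_translates hp hm u) (integrable_prod_translates hp hm' w)]
  refine (enorm_integral_le_lintegral_enorm _).trans ?_
  have h1 := eLpNorm_prod_sub_prod_le (μ := volume) (s := Finset.univ) (p := p)
    (a := translates h u) (b := translates h' w)
    (fun i _ => (memLp_translates (hm i) u).1) (fun i _ => (memLp_translates (hm' i) w).1) hp.le hC
    (fun i _ => (eLpNorm_comp_sub _ (hm i).1 _ _).trans_le (hmC i))
    (fun i _ => (eLpNorm_comp_sub _ (hm' i).1 _ _).trans_le (hmC' i))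
  rw [hp, inv_one, eLpNorm_one_eq_lintegral_enorm, Finset.card_univ, Fintype.card_fin] at h1
  exact h1

theorem exists_abs_phi_le (hp : ∑ i, (p i)⁻¹ = 1) (hm : ∀ i, MemLp (h i) (p i) volume) :
    ∃ C : ℝ, ∀ u, ‖phi h u‖ ≤ C := by
  refine ⟨(∏ i, eLpNorm (h i) (p i) volume).toReal, fun u => ?_⟩
  have h1 : ‖phi h u‖ₑ ≤ ∏ i, eLpNorm (h i) (p i) volume := by
    rw [phi_eq_integral_prod_translates]
    refine (enorm_integral_le_lintegral_enorm _).trans ?_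
    have h2 := eLpNorm_prod_le (μ := volume) (s := Finset.univ) (p := p) (a := translates h u)
      (fun i _ => (memLp_translates (hm i) u).1)
    rw [hp, inv_one, eLpNorm_one_eq_lintegral_enorm] at h2
    refine h2.trans (le_of_eq ?_)
    exact Finset.prod_congr rfl fun i _ => eLpNorm_comp_sub _ (hm i).1 _ _
  rw [← toReal_enorm]
  exact ENNReal.toReal_mono (ENNReal.prod_ne_top fun i _ => (hm i).2.ne) h1

/-- Bounded integrable functions lie in `L^(n+1)`. Giving all factors this finite exponent makes
translation continuous in norm, with inverses summing to one. -/
theorem continuousAt_phi_of_bounded (hint : ∀ i, Integrable (h i))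
    (hb : ∀ i, MemLp (h i) ∞ volume) : ContinuousAt (phi h) 0 := by
  set r : ℝ≥0∞ := ((n + 1 : ℕ) : ℝ≥0∞) with hr
  have hr1 : 1 ≤ r := by rw [hr]; exact_mod_cast Nat.succ_pos n
  have hm : ∀ i, MemLp (h i) r volume := fun i =>
    memLp_of_integrable_of_memLp (hint i) (hb i) hr1 le_top
  have hsum : ∑ _i : Fin (n + 1), r⁻¹ = 1 := by
    rw [Finset.sum_const, Finset.card_univ, Fintype.card_fin, nsmul_eq_mul]
    exact ENNReal.mul_inv_cancel (zero_lt_one.trans_le hr1).ne' (ENNReal.natCast_ne_top _)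
  set C : ℝ≥0∞ := 1 + ∑ i, eLpNorm (h i) r volume with hC
  have hCtop : C ≠ ∞ := ENNReal.add_ne_top.2 ⟨ENNReal.one_ne_top,
    ENNReal.sum_ne_top.2 fun i _ => (hm i).2.ne⟩
  have hmC : ∀ i, eLpNorm (h i) r volume ≤ C := fun i =>
    (Finset.single_le_sum (f := fun i => eLpNorm (h i) r volume) (fun _ _ => zero_le)
      (Finset.mem_univ i)).trans le_add_self
  rw [ContinuousAt, tendsto_iff_edist_tendsto_0]
  have hlim : Tendsto (fun u : Fin n → ℝ => C ^ (n + 1) *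
      ∑ i, eLpNorm (translates h u i - translates h 0 i) r volume) (𝓝 0) (𝓝 0) := by
    have h1 : Tendsto (fun u : Fin n → ℝ =>
        ∑ i, eLpNorm (translates h u i - translates h 0 i) r volume) (𝓝 0)
        (𝓝 (∑ _i : Fin (n + 1), 0)) := by
      refine tendsto_finsetSum _ fun i _ => ?_
      have h2 : Tendsto (fun u : Fin n → ℝ => (Fin.cons 0 u : Fin (n + 1) → ℝ) i) (𝓝 0) (𝓝 0) := by
        refine Fin.cases ?_ (fun j => ?_) i
        · simp only [Fin.cons_zero]
          exact tendsto_const_nhds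
        · simp only [Fin.cons_succ]
          exact (continuous_apply j).tendsto 0
      refine ((tendsto_eLpNorm_translate_sub hr1 (ENNReal.natCast_ne_top _) (hm i)).comp
        h2).congr fun u => ?_
      have h3 : translates h 0 i = h i := by
        funext x
        have : (Fin.cons 0 (0 : Fin n → ℝ) : Fin (n + 1) → ℝ) i = 0 := by
          refine Fin.cases ?_ (fun j => ?_) i <;> simp
        rw [translates, this, sub_zero]
      rw [h3]
      rfl
    rw [Finset.sum_const_zero] at h1
    have h2 := ENNReal.Tendsto.const_mul h1 (Or.inr (ENNReal.pow_ne_top (n := n + 1) hCtop))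
    rwa [mul_zero] at h2
  refine tendsto_of_tendsto_of_tendsto_of_le_of_le tendsto_const_nhds hlim (fun _ => zero_le)
    fun u => ?_
  rw [edist_eq_enorm_sub]
  exact abs_phi_sub_phi_le (p := fun _ => r) hsum hm hm le_self_add hmC hmC u 0

/-- Translation is not continuous in `L^∞`, and some exponents may be infinite. Truncating the
factors approximates `phi h` uniformly by correlation functions of bounded functions, continuous at
`0`. -/
theorem continuousAt_phi (hint : ∀ i, Integrable (h i)) (hp : ∑ i, (p i)⁻¹ = 1)
    (hm : ∀ i, MemLp (h i) (p i) volume) : ContinuousAt (phi h) 0 := by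
  set C : ℝ≥0∞ := 1 + ∑ i, eLpNorm (h i) (p i) volume with hC
  have hCtop : C ≠ ∞ := ENNReal.add_ne_top.2 ⟨ENNReal.one_ne_top,
    ENNReal.sum_ne_top.2 fun i _ => (hm i).2.ne⟩
  have hmC : ∀ i, eLpNorm (h i) (p i) volume ≤ C := fun i =>
    (Finset.single_le_sum (f := fun i => eLpNorm (h i) (p i) volume) (fun _ _ => zero_le)
      (Finset.mem_univ i)).trans le_add_self
  have hC0 : 0 < C.toReal := ENNReal.toReal_pos (zero_lt_one.trans_le le_self_add).ne' hCtop
  rw [Metric.continuousAt_iff']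
  intro ε hε
  set η := ε / 3 / (C.toReal ^ (n + 1) * (n + 1)) with hη
  have hη0 : 0 < η := by positivity
  choose K hK using fun i => exists_eLpNorm_sub_trunc_le (hm i) hη0
  set B := ∑ i, |K i| with hB
  have hB0 : 0 ≤ B := Finset.sum_nonneg fun i _ => abs_nonneg _
  have hKB : ∀ i, K i ≤ B := fun i => (le_abs_self _).trans
    (Finset.single_le_sum (f := fun i => |K i|) (fun _ _ => abs_nonneg _) (Finset.mem_univ i))
  set g : Fin (n + 1) → ℝ → ℝ := fun i x => trunc B (h i x) with hg
  have hgm : ∀ i, MemLp (g i) (p i) volume := fun i => memLp_trunc (hm i) B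
  have hgC : ∀ i, eLpNorm (g i) (p i) volume ≤ C := fun i =>
    (eLpNorm_mono fun x => abs_trunc_le_abs B (h i x)).trans (hmC i)
  have hgi : ∀ i, Integrable (g i) := fun i =>
    memLp_one_iff_integrable.1 (memLp_trunc (memLp_one_iff_integrable.2 (hint i)) B)
  have hgb : ∀ i, MemLp (g i) ∞ volume := fun i =>
    memLp_top_of_bound (hgi i).1 B (ae_of_all _ fun x => abs_trunc_le hB0 _)
  have hclose : ∀ u, dist (phi h u) (phi g u) ≤ ε / 3 := by
    intro u
    have h1 := abs_phi_sub_phi_le hp hm hgm le_self_add hmC hgC u u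
    have h2 : ∑ i, eLpNorm (translates h u i - translates g u i) (p i) volume
        ≤ ∑ _i : Fin (n + 1), ENNReal.ofReal η := by
      refine Finset.sum_le_sum fun i _ => ?_
      exact (eLpNorm_comp_sub (fun x => h i x - trunc B (h i x)) ((hm i).1.sub (hgm i).1)
        _ _).trans_le (hK i B (hKB i))
    have h3 : C ^ (n + 1) * ∑ _i : Fin (n + 1), ENNReal.ofReal η = ENNReal.ofReal (ε / 3) := by
      rw [Finset.sum_const, Finset.card_univ, Fintype.card_fin, nsmul_eq_mul,
        ← ENNReal.ofReal_toReal hCtop, ← ENNReal.ofReal_natCast, ← ENNReal.ofReal_pow hC0.le,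
        ← ENNReal.ofReal_mul (by positivity), ← ENNReal.ofReal_mul (by positivity)]
      congr 1
      rw [hη]
      push_cast
      field_simp
    have h4 := h1.trans ((mul_le_mul_right h2 _).trans h3.le)
    rw [← ofReal_norm] at h4
    rw [dist_eq_norm]
    exact (ENNReal.ofReal_le_ofReal_iff (by positivity)).1 h4
  have hcont := Metric.continuousAt_iff'.1 (continuousAt_phi_of_bounded hgi hgb) (ε / 3)
    (by positivity)
  filter_upwards [hcont] with u hu
  have h1 := hclose u
  have h2 := hclose 0
  rw [dist_comm] at h2
  have h3 := dist_triangle4 (phi h u) (phi g u) (phi g 0) (phi h 0)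
  linarith

/-- Exponents larger than one can be lowered so that their inverses sum up to one. -/
theorem exists_exponents_sum_inv_eq_one (hp1 : ∀ i, 1 < p i) (hp : ∑ i, (p i)⁻¹ ≤ 1) :
    ∃ r : Fin (n + 1) → ℝ≥0∞, (∀ i, 1 ≤ r i) ∧ (∀ i, r i ≤ p i) ∧ ∑ i, (r i)⁻¹ = 1 := by
  set c : Fin (n + 1) → ℝ := fun i => ((p i)⁻¹).toReal with hc
  have hinv : ∀ i, (p i)⁻¹ < 1 := fun i => ENNReal.inv_lt_one.2 (hp1 i)
  have hc0 : ∀ i, 0 ≤ c i := fun i => ENNReal.toReal_nonneg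
  have hc1 : ∀ i, c i < 1 := fun i => by
    rw [hc, ← ENNReal.toReal_one]
    exact (ENNReal.toReal_lt_toReal ((hinv i).trans ENNReal.one_lt_top).ne ENNReal.one_ne_top).2
      (hinv i)
  have hcp : ∀ i, ENNReal.ofReal (c i) = (p i)⁻¹ := fun i =>
    ENNReal.ofReal_toReal ((hinv i).trans ENNReal.one_lt_top).ne
  set σ := ∑ i, c i with hσ
  have hσ1 : σ ≤ 1 := by
    have h1 : ENNReal.ofReal σ ≤ ENNReal.ofReal 1 := by
      rw [hσ, ENNReal.ofReal_sum_of_nonneg fun i _ => hc0 i, ENNReal.ofReal_one]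
      simpa only [hcp] using hp
    exact (ENNReal.ofReal_le_ofReal_iff zero_le_one).1 h1
  set D := ∑ i, (1 - c i) with hD
  have hD0 : 0 < D := Finset.sum_pos (fun i _ => sub_pos.2 (hc1 i)) Finset.univ_nonempty
  have hDeq : D = n + 1 - σ := by
    rw [hD, Finset.sum_sub_distrib, hσ]
    simp
  -- All inverse exponents move towards `1` by the same proportion `θ`, the one that brings their
  -- sum to `1`; `D` is positive since each `p i` exceeds `1`.
  set θ := (1 - σ) / D with hθ
  have hθ0 : 0 ≤ θ := div_nonneg (by linarith) hD0.le
  have hθ1 : θ ≤ 1 := by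
    rw [hθ, div_le_one hD0, hDeq]
    have : (0 : ℝ) ≤ n := Nat.cast_nonneg n
    linarith
  set d : Fin (n + 1) → ℝ := fun i => c i + θ * (1 - c i) with hd
  have hcd : ∀ i, c i ≤ d i := fun i => by
    have := mul_nonneg hθ0 (sub_pos.2 (hc1 i)).le
    simp only [hd]
    linarith
  have hd1 : ∀ i, d i ≤ 1 := fun i => by
    have := mul_le_mul_of_nonneg_right hθ1 (sub_pos.2 (hc1 i)).le
    simp only [hd]
    linarith
  have hdsum : ∑ i, d i = 1 := by
    simp only [hd]
    rw [Finset.sum_add_distrib, ← Finset.mul_sum, ← hσ, ← hD, hθ, div_mul_cancel₀ _ hD0.ne']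
    ring
  refine ⟨fun i => (ENNReal.ofReal (d i))⁻¹, fun i => ?_, fun i => ?_, ?_⟩
  · rw [ENNReal.one_le_inv, ← ENNReal.ofReal_one]
    exact ENNReal.ofReal_le_ofReal (hd1 i)
  · rw [ENNReal.inv_le_iff_inv_le, ← hcp]
    exact ENNReal.ofReal_le_ofReal (hcd i)
  · simp only [inv_inv]
    rw [← ENNReal.ofReal_sum_of_nonneg fun i _ => (hc0 i).trans (hcd i), hdsum, ENNReal.ofReal_one]

theorem integrable_prod_of_memLp (hp : ∑ i, (p i)⁻¹ = 1) (hm : ∀ i, MemLp (h i) (p i) volume) :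
    Integrable fun x => ∏ i, h i x := by
  have h1 := MemLp.prod' (s := Finset.univ) fun i _ => hm i
  rw [hp, inv_one] at h1
  exact memLp_one_iff_integrable.1 h1

/-- The correlation function is integrable by Fubini and bounded by Hölder, hence in every `L^m`
with `m ≥ 1`; for `m = 0` measurability is enough. -/
theorem tendsto_Delta_of_memLp (hint : ∀ i, Integrable (h i)) (hp : ∑ i, (p i)⁻¹ = 1)
    (hm : ∀ i, MemLp (h i) (p i) volume) : Tendsto (Delta h) atTop (𝓝 0) := by
  cases n with
  | zero => exact tendsto_Delta_of_unique hint
  | succ m =>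
    refine tendsto_Delta_of_phi hint ?_ (continuousAt_phi hint hp hm)
    have hphi : Integrable (phi h) := by
      have h1 := (integrable_phi_neg hint).comp_neg
      simpa only [neg_neg] using h1
    rcases Nat.eq_zero_or_pos m with rfl | hm0
    · rw [Nat.cast_zero, memLp_zero_iff_aestronglyMeasurable]
      exact hphi.1
    · obtain ⟨C, hC⟩ := exists_abs_phi_le hp hm
      refine memLp_of_integrable_of_memLp hphi (memLp_top_of_bound hphi.1 C (ae_of_all _ hC))
        ?_ le_top
      exact_mod_cast hm0

end

end TruncatedToeplitz

end

/-! ### The main theorem -/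

theorem theorem3p1 (n : ℕ) (h : Fin (n + 1) → ℝ → ℝ)
    (hint : ∀ i, Integrable (h i) volume) (hsymm : ∀ i x, h i (-x) = h i x) :
    -- the operators whose trace is taken are trace class
    (∀ T : ℝ, 0 < T → TruncatedToeplitz.IsTraceClass (TruncatedToeplitz.toeplitzProd h T)) ∧
    -- (A1)
    (∀ p : Fin (n + 1) → ℝ≥0∞, (∀ i, 1 < p i) → (∀ i, MemLp (h i) (p i) volume) →
      ∑ i, (p i)⁻¹ ≤ 1 →
        Integrable (fun x => ∏ i, h i x) volume ∧
          Tendsto (TruncatedToeplitz.Delta h) atTop (𝓝 0)) ∧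
    -- (A2), where the number of functions is m = n + 1, so that m - 2 = n - 1
    (1 ≤ n → Integrable (fun x => ∏ i, h i x) volume →
      MemLp (TruncatedToeplitz.phi h) ((n - 1 : ℕ) : ℝ≥0∞) volume →
      ContinuousAt (TruncatedToeplitz.phi h) 0 →
        Tendsto (TruncatedToeplitz.Delta h) atTop (𝓝 0)) := by
  refine ⟨fun T hT => TruncatedToeplitz.isTraceClass_toeplitzProd hint hT.le,
    fun p hp1 hm hp => ?_, fun hn _ hphi h0 => ?_⟩
  -- Each `h i` lies in `L^1` and in `L^(p i)`, hence in every space between; this permits the exact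
  -- Hölder exponents `r i`.
  · obtain ⟨r, hr1, hrp, hr⟩ := TruncatedToeplitz.exists_exponents_sum_inv_eq_one hp1 hp
    have hmr : ∀ i, MemLp (h i) (r i) volume := fun i =>
      TruncatedToeplitz.memLp_of_integrable_of_memLp (hint i) (hm i) (hr1 i) (hrp i)
    exact ⟨TruncatedToeplitz.integrable_prod_of_memLp hr hmr,
      TruncatedToeplitz.tendsto_Delta_of_memLp hint hr hmr⟩
  · obtain ⟨m, rfl⟩ : ∃ m, n = m + 1 := ⟨n - 1, by omega⟩
    exact TruncatedToeplitz.tendsto_Delta_of_phi hint hphi h0
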